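/- Let $\mathbb{K}$ be a commutative ring with unit. A (small) $\mathbb{K}$-category is a small category whose Hom sets are $\mathbb{K}$-modules with $\mathbb{K}$-bilinear composition; let $\mathsf{Cat}_{\mathbb{K}}$ be the category of small $\mathbb{K}$-categories and $\mathbb{K}$-linear functors, and regard every $\mathbb{K}$-algebra as a $\mathbb{K}$-category with a single object. For $A\in\mathsf{Cat}_{\mathbb{K}}$ let $\mathsf{Mod}\,A$ be the category of $\mathbb{K}$-linear functors $A^{\mathrm{op}}\to\mathsf{Mod}\,\mathbb{K}$. A $\mathbb{K}$-linear functor $F\colon A\to B$ is called a Morita equivalence if extension of scalars $\mathsf{Mod}\,A\to\mathsf{Mod}\,B$ along $F$ (the left adjoint of the restriction functor $M\mapsto M\circ F^{\mathrm{op}}$) is an equivalence of categories, and two $\mathbb{K}$-categories are called Morita equivalent if they are connected by a finite zigzag of Morita equivalences. Let $\mathrm{Ho}(\mathsf{Cat}_{\mathbb{K}})=\mathsf{Cat}_{\mathbb{K}}[\{\text{Morita equivalences}\}^{-1}]$ be the localized category, with the tensor product induced by that of $\mathsf{Cat}_{\mathbb{K}}$: $A\otimes B$ has object set $\mathrm{ob}\,A\times\mathrm{ob}\,B$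 and Hom modules $(A\otimes B)((x,y),(x',y'))=A(x,x')\otimes_{\mathbb{K}}B(y,y')$, and the unit is $\mathbb{K}$. An object $A$ of $\mathrm{Ho}(\mathsf{Cat}_{\mathbb{K}})$ is $\otimes$-invertible if there is an object $B$ with $A\otimes B\simeq\mathbb{K}$ in $\mathrm{Ho}(\mathsf{Cat}_{\mathbb{K}})$. Then a small $\mathbb{K}$-category $A$ is a $\otimes$-invertible object of $\mathrm{Ho}(\mathsf{Cat}_{\mathbb{K}})$ if and only if there is an Azumaya $\mathbb{K}$-algebra $R$ such that $A$ and $R$ are Morita equivalent. -/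

import Mathlib

open CategoryTheory
open scoped TensorProduct

universe u

/-- A small `K`-category: a small category whose Hom sets are `K`-modules such that composition
is `K`-bilinear. -/
structure KCat (K : Type u) [CommRing K] : Type (u + 1) where
  carrier : Type u
  [category : Category.{u} carrier]
  [preadditive : Preadditive carrier]
  [linear : Linear K carrier]

namespace KCat

variable {K : Type u} [CommRing K]

instance : CoeSort (KCat K) (Type u) := ⟨KCat.carrier⟩

attribute [instance] category preadditive linear

/-- A `K`-linear functor: a functor whose structure maps on Hom modules are `K`-linear. -/
@[ext]
structure Hom (A B : KCat K) : Type u where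
  functor : A ⥤ B
  additive : functor.Additive
  linear : functor.Linear K

attribute [instance] Hom.additive Hom.linear

/-- The category `Cat_K` of small `K`-categories and `K`-linear functors. -/
instance : Category (KCat K) where
  Hom := Hom
  id A := ⟨𝟭 A, inferInstance, inferInstance⟩
  comp F G := ⟨F.functor ⋙ G.functor, inferInstance, inferInstance⟩

/-! ### Modules and Morita equivalences -/

/-- A functor `Aᵒᵖ ⥤ Mod K` is a right `A`-module if it is `K`-linear. -/
structure IsModule (A : KCat K) (M : (A : Type u)ᵒᵖ ⥤ ModuleCat.{u} K) : Prop where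
  map_add : ∀ {x y : A} (f g : x ⟶ y), M.map (f + g).op = M.map f.op + M.map g.op
  map_smul : ∀ {x y : A} (r : K) (f : x ⟶ y), M.map (r • f).op = r • M.map f.op

/-- The category `Mod A` of right `A`-modules: `K`-linear functors `Aᵒᵖ ⥤ Mod K` and all natural
transformations between them. -/
abbrev Mod (A : KCat K) := ObjectProperty.FullSubcategory (IsModule A)

/-- Restriction of scalars `Mod B ⥤ Mod A` along `F : A ⟶ B`, sending `M` to `M ∘ Fᵒᵖ`. -/
def restrictScalars {A B : KCat K} (F : A ⟶ B) : Mod B ⥤ Mod A :=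
  ObjectProperty.lift _
    (ObjectProperty.ι _ ⋙ (Functor.whiskeringLeft _ _ (ModuleCat.{u} K)).obj F.functor.op)
    (fun M =>
      { map_add := fun f g => by
          have := M.property.map_add (F.functor.map f) (F.functor.map g)
          rw [← F.functor.map_add] at this
          exact this
        map_smul := fun r f => by
          have := M.property.map_smul r (F.functor.map f)
          rw [← F.functor.map_smul] at this
          exact this })

/-- A `K`-linear functor `F : A ⟶ B` is a Morita equivalence if extension of scalars
`Mod A ⥤ Mod B` along `F`, i.e. the left adjoint of restriction of scalars
(`M ↦ M ⊗_A B`, the `K`-linear left Kan extension of `A ⥤ B ⥤ Mod B` along the Yoneda embedding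
`A ⥤ Mod A`), is an equivalence of categories. -/
def IsMoritaEquivalence {A B : KCat K} (F : A ⟶ B) : Prop :=
  ∃ E : Mod A ⥤ Mod B, Nonempty (E ⊣ restrictScalars F) ∧ E.IsEquivalence

/-- Two `K`-categories are Morita equivalent if they are connected by a finite zigzag of Morita
equivalences, i.e. by the equivalence relation generated by the existence of a Morita
equivalence `A ⟶ B`. -/
def MoritaEquivalent (A B : KCat K) : Prop :=
  Relation.EqvGen (fun X Y : KCat K => ∃ F : X ⟶ Y, IsMoritaEquivalence F) A B

/-! ### Algebras as `K`-categories with a single object -/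

/-- The object set of an algebra seen as a `K`-category: a single point. -/
inductive AlgObj (R : Type u) : Type u
  | star : AlgObj R

section

variable (R : Type u) [Ring R]

instance : Category.{u} (AlgObj R) where
  Hom _ _ := R
  id _ := (1 : R)
  comp f g := (g * f : R)
  id_comp f := mul_one (M := R) f
  comp_id f := one_mul (M := R) f
  assoc f g h := (mul_assoc (G := R) h g f).symm

instance : Preadditive (AlgObj R) where
  homGroup _ _ := inferInstanceAs (AddCommGroup R)
  add_comp _ _ _ f f' g := mul_add (R := R) g f f'
  comp_add _ _ _ f g g' := add_mul (R := R) g g' f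

instance [Algebra K R] : Linear K (AlgObj R) where
  homModule _ _ := inferInstanceAs (Module K R)
  smul_comp _ _ _ r f g := mul_smul_comm (α := K) (β := R) r g f
  comp_smul _ _ _ f r g := smul_mul_assoc (α := K) (β := R) r g f

variable (K) in
/-- A `K`-algebra `R` as a `K`-category with a single object whose endomorphism algebra is `R`. -/
def ofAlgebra [Algebra K R] : KCat K where
  carrier := AlgObj R

end

/-! ### Tensor product of `K`-categories -/

/-- The objects of `A ⊗ B`: pairs of an object of `A` and an object of `B`. -/
structure TensorObj (A B : KCat K) : Type u where
  fst : A
  snd : B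

/-- The Hom modules `(A ⊗ B)((x, y), (x', y')) = A(x, x') ⊗[K] B(y, y')`. -/
abbrev TensorHom {A B : KCat K} (p q : TensorObj A B) : Type u :=
  (p.fst ⟶ q.fst) ⊗[K] (p.snd ⟶ q.snd)

/-- Composition in `A ⊗ B`: the bilinear map with
`(f ⊗ g) ≫ (f' ⊗ g') = (f ≫ f') ⊗ (g ≫ g')`. -/
def tensorComp {A B : KCat K} (p q r : TensorObj A B) :
    TensorHom p q →ₗ[K] TensorHom q r →ₗ[K] TensorHom p r :=
  TensorProduct.map₂ (Linear.comp (S := K) p.fst q.fst r.fst)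
    (Linear.comp (S := K) p.snd q.snd r.snd)

theorem tensorComp_tmul {A B : KCat K} {p q r : TensorObj A B}
    (f : p.fst ⟶ q.fst) (g : p.snd ⟶ q.snd) (f' : q.fst ⟶ r.fst) (g' : q.snd ⟶ r.snd) :
    tensorComp p q r (f ⊗ₜ[K] g) (f' ⊗ₜ[K] g') = (f ≫ f') ⊗ₜ[K] (g ≫ g') := rfl

theorem tensorComp_id_left {A B : KCat K} {p q : TensorObj A B} (f : TensorHom p q) :
    tensorComp p p q (𝟙 p.fst ⊗ₜ[K] 𝟙 p.snd) f = f := by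
  induction f using TensorProduct.induction_on with
  | zero => simp
  | tmul a b => simp [tensorComp_tmul]
  | add a b ha hb => rw [map_add, ha, hb]

theorem tensorComp_id_right {A B : KCat K} {p q : TensorObj A B} (f : TensorHom p q) :
    tensorComp p q q f (𝟙 q.fst ⊗ₜ[K] 𝟙 q.snd) = f := by
  induction f using TensorProduct.induction_on with
  | zero => simp
  | tmul a b => simp [tensorComp_tmul]
  | add a b ha hb => rw [map_add, LinearMap.add_apply, ha, hb]

theorem tensorComp_assoc {A B : KCat K} {p q r s : TensorObj A B}
    (f : TensorHom p q) (g : TensorHom q r) (h : TensorHom r s) :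
    tensorComp p r s (tensorComp p q r f g) h = tensorComp p q s f (tensorComp q r s g h) := by
  induction f using TensorProduct.induction_on with
  | zero => simp
  | add a b ha hb => simp only [map_add, LinearMap.add_apply, ha, hb]
  | tmul a b =>
    induction g using TensorProduct.induction_on with
    | zero => simp
    | add c d hc hd => simp only [map_add, LinearMap.add_apply, hc, hd]
    | tmul c d =>
      induction h using TensorProduct.induction_on with
      | zero => simp
      | add e e' he he' => simp only [map_add, he, he']
      | tmul e e' => simp [tensorComp_tmul]

instance (A B : KCat K) : Category.{u} (TensorObj A B) where
  Hom p q := TensorHom p q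
  id p := 𝟙 p.fst ⊗ₜ[K] 𝟙 p.snd
  comp {p q r} f g := tensorComp p q r f g
  id_comp f := tensorComp_id_left f
  comp_id f := tensorComp_id_right f
  assoc f g h := tensorComp_assoc f g h

instance (A B : KCat K) : Preadditive (TensorObj A B) where
  homGroup p q := inferInstanceAs (AddCommGroup (TensorHom p q))
  add_comp p q r f f' g := (tensorComp p q r).map_add₂ f f' g
  comp_add p q r f g g' := (tensorComp p q r f).map_add g g'

instance (A B : KCat K) : Linear K (TensorObj A B) where
  homModule p q := inferInstanceAs (Module K (TensorHom p q))
  smul_comp p q r c f g := (tensorComp p q r).map_smul₂ c f g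
  comp_smul p q r f c g := (tensorComp p q r f).map_smul c g

/-- The tensor product `A ⊗ B` of two `K`-categories. -/
def tensor (A B : KCat K) : KCat K where
  carrier := TensorObj A B

variable (K) in
/-- The unit of the tensor product: the `K`-category with one object whose endomorphism
algebra is `K`. -/
def tensorUnit : KCat K := ofAlgebra K K

/-! ### The Morita homotopy category -/

variable (K) in
/-- The class of Morita equivalences in `Cat_K`. -/
def moritaEquivalences : MorphismProperty (KCat K) := fun _ _ F => IsMoritaEquivalence F

variable (K) in
/-- The homotopy category `Ho(Cat_K) = Cat_K[{Morita equivalences}⁻¹]`. -/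
abbrev Ho := (moritaEquivalences K).Localization

variable (K) in
/-- The localization functor `Cat_K ⥤ Ho(Cat_K)`. -/
abbrev toHo : KCat K ⥤ Ho K := (moritaEquivalences K).Q

/-- The `K`-category underlying an object of `Ho(Cat_K)`; the localization functor is bijective on
objects. -/
def Ho.out (X : Ho K) : KCat K := (Localization.Construction.objEquiv (moritaEquivalences K)).symm X

/-- The tensor product of objects of `Ho(Cat_K)`. It is the one of `Cat_K`: the localization
functor is strictly monoidal and bijective on objects. -/
def Ho.tensor (X Y : Ho K) : Ho K := (toHo K).obj (KCat.tensor X.out Y.out)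

variable (K) in
/-- The unit of the tensor product of `Ho(Cat_K)`. -/
def Ho.unit : Ho K := (toHo K).obj (tensorUnit K)

/-- An object `X` of the symmetric monoidal category `Ho(Cat_K)` is `⊗`-invertible if there is an
object `Y` such that `X ⊗ Y` is isomorphic to the unit. -/
def Ho.IsTensorInvertible (X : Ho K) : Prop := ∃ Y : Ho K, Nonempty (X.tensor Y ≅ Ho.unit K)

end KCat

/-! The proof replaces module categories by an elementary criterion: a `K`-linear functor is a
Morita equivalence exactly when it is fully faithful and every object of its target is a retract of
a finite sum of objects in its image (`isMoritaEquivalence_iff_isDense`). Retracts are encoded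
without sums, by writing the identity as a sum of morphisms through the image, so the criterion
visibly passes to tensor products. Restriction of scalars factors through the localization, so an
isomorphism in `Ho K` gives a linear equivalence of module categories; two `K`-categories related in
this way embed densely into one full subcategory of modules (`exists_isDense_of_iso`).

If `A ⊗ B` is isomorphic to the unit, this common extension gives finitely many generators of `A`
(`exists_finite_generators`). The endomorphism algebra `R` of their formal sum is Morita equivalent
to `A`; by symmetry `B` is replaced by an algebra `S`. Inside the common extension of `R ⊗ S` and
`K`, the object of each is a retract of a sum of copies of the object of the other. One retraction
gives generalized matrix units in `R ⊗ S`, the other a functional with value `1` at `1`. Matrix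
units invert the sandwich map of `R ⊗ S`, and the functional carries projectivity, finiteness and
bijectivity over to `R`.

Conversely, for `R` Azumaya the sandwich map identifies `R ⊗ Rᵐᵒᵖ` with the full subcategory of
`K`-modules on `R`. Since `R` is finitely generated projective and its trace ideal is the unit
ideal, `R` and `K` generate each other, so `Rᵐᵒᵖ` is a tensor inverse. -/

/-! ### Generation of an object by a family -/

section SumThrough

universe v v' w w'

variable (K : Type*) [CommRing K] {C : Type w} [Category.{v} C] [Preadditive C] [Linear K C]
  {D : Type w'} [Category.{v'} D] [Preadditive D] [Linear K D]

/-- The submodule of the morphisms `X ⟶ Y` that are sums of morphisms factoring through an object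
of the family `G`. -/
def sumThrough {ι : Type*} (G : ι → C) (X Y : C) : Submodule K (X ⟶ Y) :=
  Submodule.span K {h | ∃ (i : ι) (f : X ⟶ G i) (g : G i ⟶ Y), f ≫ g = h}

/-- An object is generated by the family `G` if its identity is a sum of morphisms factoring
through an object of the family, i.e. if it is a retract of a finite sum of such objects. -/
def GeneratedBy {ι : Type*} (G : ι → C) (X : C) : Prop := 𝟙 X ∈ sumThrough K G X X

variable {K}

theorem comp_mem_sumThrough {ι : Type*} {G : ι → C} {X Y : C} {i : ι} (f : X ⟶ G i) (g : G i ⟶ Y) :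
    f ≫ g ∈ sumThrough K G X Y :=
  Submodule.subset_span ⟨i, f, g, rfl⟩

theorem sumThrough_le {ι : Type*} {G : ι → C} {X Y : C} {S : Submodule K (X ⟶ Y)}
    (h : ∀ (i : ι) (f : X ⟶ G i) (g : G i ⟶ Y), f ≫ g ∈ S) : sumThrough K G X Y ≤ S := by
  refine Submodule.span_le.2 ?_
  rintro _ ⟨i, f, g, rfl⟩
  exact h i f g

theorem precomp_mem_sumThrough {ι : Type*} {G : ι → C} {X Y Z : C} (h : X ⟶ Y) {t : Y ⟶ Z}
    (ht : t ∈ sumThrough K G Y Z) : h ≫ t ∈ sumThrough K G X Z :=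
  (sumThrough_le (S := (sumThrough K G X Z).comap (Linear.leftComp K Z h)) fun i f g => by
    simpa using comp_mem_sumThrough (K := K) (h ≫ f) g) ht

theorem postcomp_mem_sumThrough {ι : Type*} {G : ι → C} {X Y Z : C} {t : X ⟶ Y}
    (ht : t ∈ sumThrough K G X Y) (h : Y ⟶ Z) : t ≫ h ∈ sumThrough K G X Z :=
  (sumThrough_le (S := (sumThrough K G X Z).comap (Linear.rightComp K X h)) fun i f g => by
    simpa using comp_mem_sumThrough (K := K) f (g ≫ h)) ht

theorem map_mem_sumThrough {ι : Type*} {G : ι → C} {X Y : C} {t : X ⟶ Y}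
    (ht : t ∈ sumThrough K G X Y) (F : C ⥤ D) [F.Additive] [F.Linear K] :
    F.map t ∈ sumThrough K (fun i => F.obj (G i)) (F.obj X) (F.obj Y) :=
  (sumThrough_le (S := (sumThrough K (fun i => F.obj (G i)) (F.obj X) (F.obj Y)).comap
    (F.mapLinearMap K)) fun i f g => by
    simpa using comp_mem_sumThrough (K := K) (G := fun i => F.obj (G i)) (F.map f) (F.map g)) ht

/-- Fullness lifts both factors of every summand, and faithfulness identifies the lifted sum with
`t`. Generation can therefore be tested in any ambient category, such as modules. -/
theorem mem_sumThrough_of_map {ι : Type*} {G : ι → C} {X Y : C} {t : X ⟶ Y}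
    (F : C ⥤ D) [F.Additive] [F.Linear K] [F.Full] [F.Faithful]
    (ht : F.map t ∈ sumThrough K (fun i => F.obj (G i)) (F.obj X) (F.obj Y)) :
    t ∈ sumThrough K G X Y := by
  have h : sumThrough K (fun i => F.obj (G i)) (F.obj X) (F.obj Y) ≤
      (sumThrough K G X Y).map (F.mapLinearMap K) := by
    refine sumThrough_le fun i f g => ?_
    obtain ⟨f, rfl⟩ := F.map_surjective f
    obtain ⟨g, rfl⟩ := F.map_surjective g
    exact ⟨f ≫ g, comp_mem_sumThrough f g, F.map_comp f g⟩
  obtain ⟨s, hs, hst⟩ := h ht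
  rwa [← F.map_injective hst]

theorem exists_sum_of_mem_sumThrough {ι : Type*} {G : ι → C} {X Y : C} {t : X ⟶ Y}
    (ht : t ∈ sumThrough K G X Y) :
    ∃ (n : ℕ) (i : Fin n → ι) (f : ∀ k, X ⟶ G (i k)) (g : ∀ k, G (i k) ⟶ Y),
      ∑ k, f k ≫ g k = t := by
  obtain ⟨n, c, s, rfl⟩ := Submodule.mem_span_set'.1 ht
  choose i f g h using fun k => (s k).2
  exact ⟨n, i, fun k => c k • f k, g, Finset.sum_congr rfl fun k _ => by
    rw [Linear.smul_comp, h]⟩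

namespace GeneratedBy

variable {ι : Type*} {G : ι → C} {X : C}

theorem mem_sumThrough_left (h : GeneratedBy K G X) {Y : C} (f : X ⟶ Y) :
    f ∈ sumThrough K G X Y := by
  simpa using postcomp_mem_sumThrough h f

theorem exists_sum (h : GeneratedBy K G X) :
    ∃ (n : ℕ) (i : Fin n → ι) (f : ∀ k, X ⟶ G (i k)) (g : ∀ k, G (i k) ⟶ X),
      ∑ k, f k ≫ g k = 𝟙 X :=
  exists_sum_of_mem_sumThrough h

theorem self (i : ι) : GeneratedBy K G (G i) := by
  simpa [GeneratedBy] using comp_mem_sumThrough (K := K) (G := G) (𝟙 (G i)) (𝟙 (G i))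

theorem of_sum {κ : Type*} (s : Finset κ) (i : κ → ι) (f : ∀ k, X ⟶ G (i k))
    (g : ∀ k, G (i k) ⟶ X) (h : ∑ k ∈ s, f k ≫ g k = 𝟙 X) : GeneratedBy K G X := by
  rw [GeneratedBy, ← h]
  exact Submodule.sum_mem _ fun k _ => comp_mem_sumThrough (f k) (g k)

theorem trans {κ : Type*} {G' : κ → C} (h : GeneratedBy K G X)
    (h' : ∀ i, GeneratedBy K G' (G i)) : GeneratedBy K G' X :=
  (sumThrough_le fun i f g =>
    precomp_mem_sumThrough f ((h' i).mem_sumThrough_left g) : sumThrough K G X X ≤ _) h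

theorem map (h : GeneratedBy K G X) (F : C ⥤ D) [F.Additive] [F.Linear K] :
    GeneratedBy K (fun i => F.obj (G i)) (F.obj X) := by
  simpa [GeneratedBy] using map_mem_sumThrough h F

theorem of_map (F : C ⥤ D) [F.Additive] [F.Linear K] [F.Full] [F.Faithful]
    (h : GeneratedBy K (fun i => F.obj (G i)) (F.obj X)) : GeneratedBy K G X :=
  mem_sumThrough_of_map F (by simpa [GeneratedBy] using h)

theorem of_iso {Y : C} (h : GeneratedBy K G X) (e : X ≅ Y) : GeneratedBy K G Y := by
  have := precomp_mem_sumThrough e.inv (h.mem_sumThrough_left e.hom)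
  rwa [e.inv_hom_id] at this

end GeneratedBy

end SumThrough

/-! ### Modules, the Yoneda embedding and separating families -/

namespace KCat

open Opposite

variable {K : Type u} [CommRing K]

/-- A `K`-linear functor is densely fully faithful if it is fully faithful and every object of its
target is generated by its image. -/
structure IsDense {A B : KCat K} (F : A ⟶ B) : Prop where
  full : F.functor.Full
  faithful : F.functor.Faithful
  generated : ∀ b : B, GeneratedBy K F.functor.obj b

namespace Mod

variable {A : KCat K}

/-- The action of a morphism on a module. -/
def pull (M : Mod A) {x y : A} (f : x ⟶ y) : M.obj.obj (op y) →ₗ[K] M.obj.obj (op x) :=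
  (M.obj.map f.op).hom

@[simp] theorem pull_id (M : Mod A) (x : A) (m : M.obj.obj (op x)) : M.pull (𝟙 x) m = m := by
  simp [pull]

@[simp] theorem pull_comp (M : Mod A) {x y z : A} (f : x ⟶ y) (g : y ⟶ z) (m : M.obj.obj (op z)) :
    M.pull (f ≫ g) m = M.pull f (M.pull g m) := by
  simp [pull]

theorem pull_add (M : Mod A) {x y : A} (f g : x ⟶ y) : M.pull (f + g) = M.pull f + M.pull g :=
  congr(ModuleCat.Hom.hom $(M.property.map_add f g))

theorem pull_smul (M : Mod A) {x y : A} (r : K) (f : x ⟶ y) : M.pull (r • f) = r • M.pull f :=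
  congr(ModuleCat.Hom.hom $(M.property.map_smul r f))

/-- The action of the Hom modules on an element of a module. -/
def act (M : Mod A) {y : A} (m : M.obj.obj (op y)) (x : A) : (x ⟶ y) →ₗ[K] M.obj.obj (op x) where
  toFun f := M.pull f m
  map_add' f g := by rw [pull_add]; rfl
  map_smul' r f := by rw [pull_smul]; rfl

@[simp] theorem act_apply (M : Mod A) {y : A} (m : M.obj.obj (op y)) (x : A) (f : x ⟶ y) :
    M.act m x f = M.pull f m := rfl

theorem pull_sum (M : Mod A) {x y : A} {κ : Type*} (s : Finset κ) (f : κ → (x ⟶ y))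
    (m : M.obj.obj (op y)) : M.pull (∑ k ∈ s, f k) m = ∑ k ∈ s, M.pull (f k) m :=
  map_sum (M.act m x) f s

/-- The components of a morphism of modules. -/
def ev {M N : Mod A} (φ : M ⟶ N) (x : A) : M.obj.obj (op x) →ₗ[K] N.obj.obj (op x) :=
  (φ.hom.app (op x)).hom

theorem ev_pull {M N : Mod A} (φ : M ⟶ N) {x y : A} (f : x ⟶ y) (m : M.obj.obj (op y)) :
    ev φ x (M.pull f m) = N.pull f (ev φ y m) :=
  congr($(φ.hom.naturality f.op).hom m)

@[simp] theorem ev_comp {M N P : Mod A} (φ : M ⟶ N) (ψ : N ⟶ P) (x : A) (m : M.obj.obj (op x)) :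
    ev (φ ≫ ψ) x m = ev ψ x (ev φ x m) := rfl

@[simp] theorem ev_id (M : Mod A) (x : A) (m : M.obj.obj (op x)) : ev (𝟙 M) x m = m := rfl

@[simp] theorem ev_zero {M N : Mod A} (x : A) (m : M.obj.obj (op x)) :
    ev (0 : M ⟶ N) x m = 0 := rfl

theorem hom_ext {M N : Mod A} {φ ψ : M ⟶ N} (h : ∀ x m, ev φ x m = ev ψ x m) : φ = ψ := by
  ext x m
  exact h (unop x) m

/-- A morphism of modules from its components. -/
def homMk {M N : Mod A} (φ : ∀ x, M.obj.obj (op x) →ₗ[K] N.obj.obj (op x))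
    (h : ∀ (x y : A) (f : x ⟶ y) m, φ x (M.pull f m) = N.pull f (φ y m)) : M ⟶ N :=
  ObjectProperty.homMk
    { app := fun x => ModuleCat.ofHom (φ (unop x))
      naturality := fun y x f => by
        ext m
        exact h _ _ f.unop m }

@[simp] theorem ev_homMk {M N : Mod A} (φ : ∀ x, M.obj.obj (op x) →ₗ[K] N.obj.obj (op x))
    (h : ∀ (x y : A) (f : x ⟶ y) m, φ x (M.pull f m) = N.pull f (φ y m)) (x : A) :
    ev (homMk φ h) x = φ x := rfl

variable (A) in
/-- The Yoneda embedding. -/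
def yoneda : (A : Type u) ⥤ Mod A :=
  ObjectProperty.lift _ (linearYoneda K A) fun a =>
    { map_add := fun f g => by
        ext h
        exact Preadditive.add_comp _ _ _ f g h
      map_smul := fun r f => by
        ext h
        exact Linear.smul_comp _ _ _ r f h }

/-- The elements of a representable module are the morphisms to the representing object. -/
def elem (x a : A) : (x ⟶ a) ≃ₗ[K] ((yoneda A).obj a).obj.obj (op x) where
  toFun f := f
  invFun f := f
  map_add' _ _ := rfl
  map_smul' _ _ := rfl
  left_inv _ := rfl
  right_inv _ := rfl

@[simp] theorem pull_elem {a x y : A} (f : x ⟶ y) (g : y ⟶ a) :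
    ((yoneda A).obj a).pull f (elem y a g) = elem x a (f ≫ g) := rfl

@[simp] theorem ev_yoneda_map_elem {a b : A} (g : a ⟶ b) (x : A) (f : x ⟶ a) :
    ev ((yoneda A).map g) x (elem x a f) = elem x b (f ≫ g) := rfl

/-- The morphism from a representable module given by an element. -/
def ofElem {M : Mod A} {a : A} (m : M.obj.obj (op a)) : (yoneda A).obj a ⟶ M :=
  homMk (fun x => M.act m x ∘ₗ (elem x a).symm.toLinearMap)
    fun _ _ f g => M.pull_comp f ((elem _ a).symm g) m

@[simp] theorem ev_ofElem_elem {M : Mod A} {a : A} (m : M.obj.obj (op a)) (x : A) (f : x ⟶ a) :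
    ev (ofElem m) x (elem x a f) = M.pull f m := rfl

theorem ev_elem {M : Mod A} {a : A} (φ : (yoneda A).obj a ⟶ M) (x : A) (f : x ⟶ a) :
    ev φ x (elem x a f) = M.pull f (ev φ a (elem a a (𝟙 a))) := by
  rw [← ev_pull, pull_elem, Category.comp_id]

theorem yoneda_hom_ext {M : Mod A} {a : A} {φ ψ : (yoneda A).obj a ⟶ M}
    (h : ev φ a (elem a a (𝟙 a)) = ev ψ a (elem a a (𝟙 a))) : φ = ψ := by
  refine hom_ext fun x f => ?_
  obtain ⟨f, rfl⟩ := (elem x a).surjective f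
  rw [ev_elem φ, h, ← ev_elem ψ]

instance : (yoneda A).Additive where
  map_add := hom_ext fun _ h => Preadditive.comp_add _ _ _ ((elem _ _).symm h) _ _

instance : (yoneda A).Linear K where
  map_smul f r := hom_ext fun _ h => Linear.comp_smul _ _ _ ((elem _ _).symm h) r f

instance : (yoneda A).Faithful where
  map_injective {a b f g} h := by
    have : ev ((yoneda A).map f) a (elem a a (𝟙 a)) = ev ((yoneda A).map g) a (elem a a (𝟙 a)) := by
      rw [h]
    simpa using this

instance : (yoneda A).Full where
  map_surjective {a b} φ := ⟨(elem a b).symm (ev φ a (elem a a (𝟙 a))), yoneda_hom_ext (by simp)⟩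

/-- The quotient of a module by a submodule. -/
def quotient (M : Mod A) (T : ∀ x : A, Submodule K (M.obj.obj (op x)))
    (hT : ∀ (x y : A) (f : x ⟶ y), T y ≤ (T x).comap (M.pull f)) : Mod A where
  obj :=
    { obj := fun x => ModuleCat.of K (M.obj.obj x ⧸ T (unop x))
      map := fun {y x} f => ModuleCat.ofHom (Submodule.mapQ _ _ (M.pull f.unop) (hT _ _ f.unop))
      map_id := fun x => by
        ext m
        exact congrArg (Submodule.Quotient.mk (p := T (unop x))) (M.pull_id _ m)
      map_comp := fun {z y x} g f => by
        ext m
        exact congrArg (Submodule.Quotient.mk (p := T (unop x))) (M.pull_comp f.unop g.unop m) }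
  property :=
    { map_add := fun {x y} f g => by
        ext m
        exact congrArg (Submodule.Quotient.mk (p := T x)) (map_add (M.act m x) f g)
      map_smul := fun {x y} r f => by
        ext m
        exact congrArg (Submodule.Quotient.mk (p := T x)) (map_smul (M.act m x) r f) }

/-- The projection to a quotient module. -/
def toQuotient (M : Mod A) (T : ∀ x : A, Submodule K (M.obj.obj (op x)))
    (hT : ∀ (x y : A) (f : x ⟶ y), T y ≤ (T x).comap (M.pull f)) : M ⟶ M.quotient T hT :=
  homMk (N := M.quotient T hT) (fun x => (T x).mkQ) fun _ _ _ _ => rfl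

theorem ev_toQuotient_eq_zero_iff (M : Mod A) (T : ∀ x : A, Submodule K (M.obj.obj (op x)))
    (hT : ∀ (x y : A) (f : x ⟶ y), T y ≤ (T x).comap (M.pull f)) {x : A} (m : M.obj.obj (op x)) :
    ev (M.toQuotient T hT) x m = 0 ↔ m ∈ T x :=
  Submodule.Quotient.mk_eq_zero _

/-- A separating family of modules generates the representable modules. -/
theorem generatedBy_of_separating {ι : Type*} (G : ι → Mod A)
    (hG : ∀ {M N : Mod A} (φ ψ : M ⟶ N), (∀ i (f : G i ⟶ M), f ≫ φ = f ≫ ψ) → φ = ψ) (a : A) :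
    GeneratedBy K G ((yoneda A).obj a) := by
  -- `T` is the submodule of the representable module formed by the sums of morphisms through `G`.
  -- Every morphism from a `G i` lands in `T`, so the projection to the quotient by `T` agrees with
  -- `0` on the separating family. Hence it vanishes, and `𝟙 a` lies in `T`.
  let T : ∀ x : A, Submodule K (((yoneda A).obj a).obj.obj (op x)) := fun x =>
    (sumThrough K G ((yoneda A).obj x) ((yoneda A).obj a)).comap
      ((yoneda A).mapLinearMap K ∘ₗ (elem x a).symm.toLinearMap)
  have mem_T : ∀ (x : A) (f : x ⟶ a), elem x a f ∈ T x ↔ (yoneda A).map f ∈ sumThrough K G _ _ :=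
    fun _ _ => Iff.rfl
  have hT : ∀ (x y : A) (f : x ⟶ y), T y ≤ (T x).comap (((yoneda A).obj a).pull f) := by
    intro x y f g hg
    obtain ⟨g, rfl⟩ := (elem y a).surjective g
    rw [Submodule.mem_comap, pull_elem, mem_T, (yoneda A).map_comp]
    exact precomp_mem_sumThrough ((yoneda A).map f) hg
  have h0 : ((yoneda A).obj a).toQuotient T hT = 0 := by
    refine hG _ _ fun i f => hom_ext fun x m => ?_
    rw [ev_comp, ev_comp, ev_zero, ev_toQuotient_eq_zero_iff]
    obtain ⟨g, hg⟩ := (elem x a).surjective (ev f x m)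
    have h : (yoneda A).map g = ofElem m ≫ f := yoneda_hom_ext (by simp [hg])
    rw [← hg, mem_T, h]
    exact comp_mem_sumThrough _ _
  have h1 : elem a a (𝟙 a) ∈ T a := by
    rw [← ev_toQuotient_eq_zero_iff _ T hT, h0, ev_zero]
  rwa [mem_T, (yoneda A).map_id] at h1

theorem separating_yoneda {M N : Mod A} (φ ψ : M ⟶ N)
    (h : ∀ a (f : (yoneda A).obj a ⟶ M), f ≫ φ = f ≫ ψ) : φ = ψ :=
  hom_ext fun x m => by
    have := congr(ev $(h x (ofElem m)) x (elem x x (𝟙 x)))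
    simpa using this

end Mod

end KCat

/-! ### Restriction of scalars and the density criterion -/

namespace KCat

open Opposite

variable {K : Type u} [CommRing K]

namespace Mod

variable {A B : KCat K}

theorem isIso_of_bijective {M N : Mod A} (φ : M ⟶ N) (h : ∀ x, Function.Bijective (ev φ x)) :
    IsIso φ := by
  rw [← ObjectProperty.isIso_hom_iff, NatTrans.isIso_iff_isIso_app]
  exact fun x => (ConcreteCategory.isIso_iff_bijective _).2 (h (unop x))

/-- The elements of a restricted module. -/
def resElem (F : A ⟶ B) (M : Mod B) (a : A) :
    M.obj.obj (op (F.functor.obj a)) ≃ₗ[K] ((restrictScalars F).obj M).obj.obj (op a) :=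
  LinearEquiv.refl K _

@[simp] theorem pull_resElem (F : A ⟶ B) (M : Mod B) {x y : A} (f : x ⟶ y)
    (m : M.obj.obj (op (F.functor.obj y))) :
    ((restrictScalars F).obj M).pull f (resElem F M y m) =
      resElem F M x (M.pull (F.functor.map f) m) := rfl

@[simp] theorem ev_restrictScalars_map (F : A ⟶ B) {M N : Mod B} (φ : M ⟶ N) (x : A)
    (m : M.obj.obj (op (F.functor.obj x))) :
    ev ((restrictScalars F).map φ) x (resElem F M x m) =
      resElem F N x (ev φ (F.functor.obj x) m) := rfl

instance (F : A ⟶ B) : (restrictScalars F).Additive where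
  map_add := rfl

instance (F : A ⟶ B) : (restrictScalars F).Linear K where
  map_smul _ _ := rfl

/-- Coinduction of modules, the right adjoint of restriction of scalars. -/
def coind (F : A ⟶ B) (N : Mod A) : Mod B where
  obj := (yoneda B ⋙ restrictScalars F).op ⋙ (linearYoneda K (Mod A)).obj N
  property :=
    { map_add := fun f g => by
        ext φ
        exact congr($((yoneda B ⋙ restrictScalars F).map_add) ≫ φ).trans
          (Preadditive.add_comp _ _ _ _ _ φ)
      map_smul := fun r f => by
        ext φ
        exact congr($((yoneda B ⋙ restrictScalars F).map_smul r f) ≫ φ).trans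
          (Linear.smul_comp _ _ _ _ _ φ) }

/-- The elements of a coinduced module. -/
def coindElem (F : A ⟶ B) (N : Mod A) (b : B) :
    ((restrictScalars F).obj ((yoneda B).obj b) ⟶ N) ≃ₗ[K] (coind F N).obj.obj (op b) :=
  LinearEquiv.refl K _

/-- Evaluation at the identities, the counit of coinduction. -/
def coindCounit (F : A ⟶ B) (N : Mod A) : (restrictScalars F).obj (coind F N) ⟶ N :=
  homMk
    (fun a =>
      { toFun := fun φ => ev ((coindElem F N _).symm ((resElem F _ a).symm φ)) a
          (resElem F _ a (elem _ _ (𝟙 (F.functor.obj a))))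
        map_add' := fun φ ψ => rfl
        map_smul' := fun r φ => rfl })
    (fun x y f φ => by
      obtain ⟨φ, rfl⟩ := (resElem F _ y).surjective φ
      obtain ⟨φ, rfl⟩ := (coindElem F N _).surjective φ
      change ev ((restrictScalars F).map ((yoneda B).map (F.functor.map f)) ≫ φ) x
        (resElem F _ x (elem _ _ (𝟙 _))) = N.pull f (ev φ y (resElem F _ y (elem _ _ (𝟙 _))))
      rw [ev_comp, ev_restrictScalars_map, ev_yoneda_map_elem, ← ev_pull, pull_resElem, pull_elem,
        Category.id_comp, Category.comp_id])

theorem ev_coindCounit (F : A ⟶ B) (N : Mod A) (a : A)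
    (φ : (restrictScalars F).obj ((yoneda B).obj (F.functor.obj a)) ⟶ N) :
    ev (coindCounit F N) a (resElem F _ a (coindElem F N _ φ)) =
      ev φ a (resElem F _ a (elem _ _ (𝟙 (F.functor.obj a)))) := rfl

end Mod

open KCat.Mod

variable {A B : KCat K}

/-- The linear isomorphisms on Hom modules given by a fully faithful `K`-linear functor. -/
noncomputable def homLinearEquiv (F : A ⟶ B) (h₁ : F.functor.Full) (h₂ : F.functor.Faithful)
    (x y : A) : (x ⟶ y) ≃ₗ[K] (F.functor.obj x ⟶ F.functor.obj y) :=
  LinearEquiv.ofBijective (F.functor.mapLinearMap K)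
    ⟨F.functor.map_injective, F.functor.map_surjective⟩

/-- Full faithfulness makes the restriction of the module represented by `F a` the module
represented by `a`; by Yoneda its morphisms to `N` are the elements of `N` at `a`. Essential
surjectivity of restriction follows. -/
theorem isIso_coindCounit (F : A ⟶ B) (h₁ : F.functor.Full) (h₂ : F.functor.Faithful) (N : Mod A) :
    IsIso (coindCounit F N) := by
  refine isIso_of_bijective _ fun a => ⟨?_, fun m => ?_⟩
  · rw [injective_iff_map_eq_zero]
    intro φ hφ
    obtain ⟨φ, rfl⟩ := (resElem F _ a).surjective φ
    obtain ⟨φ, rfl⟩ := (coindElem F N _).surjective φ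
    rw [ev_coindCounit] at hφ
    suffices φ = 0 by simp [this]
    refine hom_ext fun x f => ?_
    obtain ⟨f, rfl⟩ := (resElem F _ x).surjective f
    obtain ⟨f, rfl⟩ := (elem _ _).surjective f
    obtain ⟨f, rfl⟩ := F.functor.map_surjective f
    have := congrArg (N.pull f) hφ
    rw [← ev_pull, pull_resElem, pull_elem, Category.comp_id, map_zero] at this
    rw [this, ev_zero]
  · refine ⟨resElem F _ a (coindElem F N _ (homMk (fun x => N.act m x ∘ₗ
      (homLinearEquiv F h₁ h₂ x a).symm.toLinearMap ∘ₗ (elem _ _).symm.toLinearMap ∘ₗ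
      (resElem F _ x).symm.toLinearMap) fun x y f g => ?_)), ?_⟩
    · obtain ⟨g, rfl⟩ := (resElem F _ y).surjective g
      obtain ⟨g, rfl⟩ := (elem _ _).surjective g
      obtain ⟨g, rfl⟩ := (homLinearEquiv F h₁ h₂ y a).surjective g
      have : F.functor.map f ≫ homLinearEquiv F h₁ h₂ y a g = homLinearEquiv F h₁ h₂ x a (f ≫ g) :=
        (F.functor.map_comp f g).symm
      rw [pull_resElem, pull_elem, this]
      simp only [LinearMap.comp_apply, LinearEquiv.coe_coe, LinearEquiv.symm_apply_apply, act_apply,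
        pull_comp]
    · have : 𝟙 (F.functor.obj a) = homLinearEquiv F h₁ h₂ a a (𝟙 a) := (F.functor.map_id a).symm
      rw [ev_coindCounit, ev_homMk, this]
      simp only [LinearMap.comp_apply, LinearEquiv.coe_coe, LinearEquiv.symm_apply_apply, act_apply,
        pull_id]

/-- A decomposition of `𝟙 b` writes each `m` at `b` as a sum of pullbacks of elements living at
image objects, where the two morphisms agree. -/
theorem faithful_restrictScalars {F : A ⟶ B} (h : IsDense F) : (restrictScalars F).Faithful where
  map_injective {M N φ ψ} hφ := by
    refine hom_ext fun b m => ?_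
    obtain ⟨n, i, f, g, hfg⟩ := (h.generated b).exists_sum
    rw [← M.pull_id b m, ← hfg, pull_sum, map_sum, map_sum]
    refine Finset.sum_congr rfl fun k _ => ?_
    rw [pull_comp, ev_pull φ (f k), ev_pull ψ (f k)]
    exact congr(N.pull (f k) (ev $hφ (i k) (M.pull (g k) m)))

/-- The extension of `ψ` to `b` is forced by a decomposition of `𝟙 b`, and one decomposition is
fixed for each `b`. -/
theorem full_restrictScalars {F : A ⟶ B} (h : IsDense F) : (restrictScalars F).Full where
  map_surjective {M N} ψ := by
    have := h.full
    choose n i f g hfg using fun b => (h.generated b).exists_sum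
    let ψ' (a : A) : M.obj.obj (op (F.functor.obj a)) →ₗ[K] N.obj.obj (op (F.functor.obj a)) :=
      (resElem F N a).symm.toLinearMap ∘ₗ ev ψ a ∘ₗ (resElem F M a).toLinearMap
    have hψ' (x y : A) (t : F.functor.obj x ⟶ F.functor.obj y) (m) :
        ψ' x (M.pull t m) = N.pull t (ψ' y m) := by
      obtain ⟨t, rfl⟩ := F.functor.map_surjective t
      exact ev_pull ψ t (resElem F M y m)
    -- The extension formula at `b` agrees with `ψ'` after pulling back along any morphism from an
    -- image object. This gives naturality and also shows that the extension restricts to `ψ`.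
    have key (b : B) (a : A) (t : F.functor.obj a ⟶ b) (m) :
        ψ' a (M.pull t m) = ∑ k, N.pull (t ≫ f b k) (ψ' (i b k) (M.pull (g b k) m)) := by
      conv_lhs => rw [← Category.comp_id t, ← hfg b, Preadditive.comp_sum, pull_sum, map_sum]
      refine Finset.sum_congr rfl fun k _ => ?_
      rw [← Category.assoc, pull_comp, hψ']
    refine ⟨homMk (fun b => ∑ k, N.pull (f b k) ∘ₗ ψ' (i b k) ∘ₗ M.pull (g b k))
      fun x y t m => ?_, hom_ext fun a m => ?_⟩
    · simp only [LinearMap.sum_apply, LinearMap.comp_apply, map_sum]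
      have hl (l) : N.pull (f x l) (ψ' (i x l) (M.pull (g x l) (M.pull t m))) =
          ∑ k, N.pull (f x l ≫ (g x l ≫ t) ≫ f y k) (ψ' (i y k) (M.pull (g y k) m)) := by
        rw [← pull_comp, key y, map_sum]
        simp only [pull_comp]
      rw [Finset.sum_congr rfl fun l _ => hl l, Finset.sum_comm]
      refine Finset.sum_congr rfl fun k _ => ?_
      rw [← pull_sum, ← pull_comp]
      simp only [← Category.assoc]
      rw [← Preadditive.sum_comp, ← Preadditive.sum_comp, hfg, Category.id_comp]
    · obtain ⟨m, rfl⟩ := (resElem F M a).surjective m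
      rw [ev_restrictScalars_map, ev_homMk]
      have : ψ' a m = _ := congrArg (ψ' a) (M.pull_id _ m).symm
      rw [key] at this
      simp only [Category.id_comp] at this
      simp only [LinearMap.sum_apply, LinearMap.comp_apply, ← this]
      rfl

theorem isEquivalence_restrictScalars {F : A ⟶ B} (h : IsDense F) :
    (restrictScalars F).IsEquivalence where
  faithful := faithful_restrictScalars h
  full := full_restrictScalars h
  essSurj :=
    ⟨fun N =>
      have := isIso_coindCounit F h.full h.faithful N
      ⟨coind F N, ⟨asIso (coindCounit F N)⟩⟩⟩

/-- The module `N` restricting to the representable of `a'` plays the role of the representable of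
`F a'`, with universal element `n` matching `𝟙 a'`. Comparing the two gives full faithfulness.
Faithfulness of restriction says that the representables of image objects separate modules, hence
generate. -/
theorem isDense_of_isEquivalence {F : A ⟶ B} (h : (restrictScalars F).IsEquivalence) :
    IsDense F := by
  have key (a' : A) : ∃ (N : Mod B) (n : N.obj.obj (op (F.functor.obj a')))
      (α : (restrictScalars F).obj N ≅ (yoneda A).obj a'),
      ev α.hom a' (resElem F N a' n) = elem a' a' (𝟙 a') :=
    ⟨(restrictScalars F).objPreimage _,
      (resElem F _ a').symm (ev ((restrictScalars F).objObjPreimageIso ((yoneda A).obj a')).inv a'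
        (elem a' a' (𝟙 a'))), (restrictScalars F).objObjPreimageIso _, by
        rw [LinearEquiv.apply_symm_apply, ← ev_comp, Iso.inv_hom_id, ev_id]⟩
  have key' {a a' : A} {N : Mod B} {n : N.obj.obj (op (F.functor.obj a'))}
      {α : (restrictScalars F).obj N ≅ (yoneda A).obj a'}
      (hα : ev α.hom a' (resElem F N a' n) = elem a' a' (𝟙 a')) (f : a ⟶ a') :
      ev α.hom a (resElem F N a (N.pull (F.functor.map f) n)) = elem a a' f := by
    rw [← pull_resElem, ev_pull, hα, pull_elem, Category.comp_id]
  refine ⟨⟨fun {a a'} g => ?_⟩, ⟨fun {a a' f f'} hf => ?_⟩, fun b => ?_⟩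
  · obtain ⟨N, n, α, hα⟩ := key a'
    let θ : (yoneda A).obj a' ⟶ (restrictScalars F).obj ((yoneda B).obj (F.functor.obj a')) :=
      ofElem (resElem F _ a' (elem _ _ (𝟙 _)))
    obtain ⟨s, hs⟩ := (restrictScalars F).map_surjective (α.hom ≫ θ)
    -- `s` carries `n` to the identity of `F a'`, so a morphism `t` into `F a'` can be recovered
    -- from the element `N.pull t n`.
    have hsn : ev s _ n = elem _ _ (𝟙 _) := by
      apply (resElem F _ a').injective
      rw [← ev_restrictScalars_map, hs, ev_comp, hα, ev_ofElem_elem, pull_id]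
    have hn (t : F.functor.obj a ⟶ F.functor.obj a') : ev s _ (N.pull t n) = elem _ _ t := by
      rw [ev_pull, hsn, pull_elem, Category.comp_id]
    let f := (elem a a').symm (ev α.hom a (resElem F N a (N.pull g n)))
    refine ⟨f, (elem _ _).injective ?_⟩
    -- It suffices that `F f` and `g` pull `n` back to the same element, which is tested after the
    -- injective `α.hom`.
    rw [← hn, ← hn g]
    congr 1
    apply (resElem F N a).injective
    have hinj : Function.Injective (ev α.hom a) := by
      refine Function.LeftInverse.injective (g := ev α.inv a) fun x => ?_
      rw [← ev_comp, Iso.hom_inv_id, ev_id]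
    apply hinj
    rw [key' hα]
    simp [f]
  · obtain ⟨N, n, α, hα⟩ := key a'
    apply (elem a a').injective
    rw [← key' hα, ← key' hα, hf]
  · refine GeneratedBy.of_map (yoneda B) (generatedBy_of_separating _ (fun {M N} φ ψ hφ => ?_) b)
    apply (restrictScalars F).map_injective
    refine hom_ext fun a m => ?_
    obtain ⟨m, rfl⟩ := (resElem F M a).surjective m
    have := congr(ev $(hφ a (ofElem m)) _ (elem _ _ (𝟙 (F.functor.obj a))))
    simpa using this

theorem isMoritaEquivalence_iff (F : A ⟶ B) :
    IsMoritaEquivalence F ↔ (restrictScalars F).IsEquivalence :=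
  ⟨fun ⟨_, ⟨adj⟩, _⟩ => adj.isEquivalence_right_of_isEquivalence_left, fun _ =>
    ⟨(restrictScalars F).inv, ⟨(restrictScalars F).asEquivalence.symm.toAdjunction⟩,
      inferInstance⟩⟩

theorem isMoritaEquivalence_iff_isDense (F : A ⟶ B) : IsMoritaEquivalence F ↔ IsDense F :=
  (isMoritaEquivalence_iff F).trans ⟨isDense_of_isEquivalence, isEquivalence_restrictScalars⟩

end KCat

namespace KCat

open Opposite KCat.Mod

variable {K : Type u} [CommRing K]

/-! ### Module categories up to isomorphism of functors -/

/-- A `K`-linear functor between module categories. -/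
structure ModFunctor (A B : KCat K) where
  functor : Mod A ⥤ Mod B
  additive : functor.Additive
  linear : functor.Linear K

attribute [instance] ModFunctor.additive ModFunctor.linear

instance instSetoidModFunctor (A B : KCat K) : Setoid (ModFunctor A B) where
  r F G := Nonempty (F.functor ≅ G.functor)
  iseqv := ⟨fun _ => ⟨Iso.refl _⟩, fun ⟨e⟩ => ⟨e.symm⟩, fun ⟨e⟩ ⟨e'⟩ => ⟨e ≪≫ e'⟩⟩

variable (K) in
/-- The category with objects the `K`-categories and morphisms from `A` to `B` the isomorphism
classes of `K`-linear functors `Mod B ⥤ Mod A`. -/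
structure ModHo : Type (u + 1) where
  cat : KCat K

namespace ModHo

instance : Category (ModHo K) where
  Hom A B := _root_.Quotient (instSetoidModFunctor B.cat A.cat)
  id A := _root_.Quotient.mk _ ⟨𝟭 _, inferInstance, inferInstance⟩
  comp {A B C} := _root_.Quotient.map₂
    (fun (F : ModFunctor B.cat A.cat) (G : ModFunctor C.cat B.cat) =>
      (⟨G.functor ⋙ F.functor, inferInstance, inferInstance⟩ : ModFunctor C.cat A.cat))
    fun _ _ ⟨e⟩ _ _ ⟨e'⟩ => ⟨Functor.isoWhiskerRight e' _ ≪≫ Functor.isoWhiskerLeft _ e⟩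
  id_comp := by
    rintro A B ⟨F⟩
    exact _root_.Quotient.sound ⟨Functor.rightUnitor _⟩
  comp_id := by
    rintro A B ⟨F⟩
    exact _root_.Quotient.sound ⟨Functor.leftUnitor _⟩
  assoc := by
    rintro A B C D ⟨F⟩ ⟨G⟩ ⟨H⟩
    exact _root_.Quotient.sound ⟨(Functor.associator _ _ _).symm⟩

/-- The isomorphism class of a `K`-linear functor. -/
def homMk {A B : KCat K} (F : Mod B ⥤ Mod A) [h₁ : F.Additive] [h₂ : F.Linear K] :
    (⟨A⟩ : ModHo K) ⟶ ⟨B⟩ :=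
  _root_.Quotient.mk _ ⟨F, h₁, h₂⟩

theorem homMk_eq_iff {A B : KCat K} (F G : Mod B ⥤ Mod A) [F.Additive] [F.Linear K]
    [G.Additive] [G.Linear K] : homMk F = homMk G ↔ Nonempty (F ≅ G) :=
  _root_.Quotient.eq

theorem homMk_comp {A B C : KCat K} (F : Mod B ⥤ Mod A) [F.Additive] [F.Linear K]
    (G : Mod C ⥤ Mod B) [G.Additive] [G.Linear K] : homMk F ≫ homMk G = homMk (G ⋙ F) :=
  rfl

theorem homMk_id (A : KCat K) : homMk (𝟭 (Mod A)) = 𝟙 _ := rfl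

theorem exists_homMk {A B : KCat K} (f : (⟨A⟩ : ModHo K) ⟶ ⟨B⟩) :
    ∃ (F : Mod B ⥤ Mod A) (_ : F.Additive) (_ : F.Linear K), f = homMk F := by
  obtain ⟨F⟩ := f
  exact ⟨F.functor, F.additive, F.linear, rfl⟩

/-- Restriction of scalars as a functor. -/
def res : KCat K ⥤ ModHo K where
  obj A := ⟨A⟩
  map F := homMk (restrictScalars F)
  map_id A := (homMk_eq_iff (restrictScalars (𝟙 A)) (𝟭 _)).2 ⟨Iso.refl _⟩
  map_comp F G :=
    (homMk_eq_iff (restrictScalars (F ≫ G)) (restrictScalars G ⋙ restrictScalars F)).2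
      ⟨Iso.refl _⟩

theorem isInvertedBy_res : (moritaEquivalences K).IsInvertedBy (res (K := K)) := by
  intro A B F hF
  have := (isMoritaEquivalence_iff F).1 hF
  let e := (restrictScalars F).asEquivalence
  have h₁ : e.functor.Additive := inferInstanceAs (restrictScalars F).Additive
  have h₂ : e.functor.Linear K := inferInstanceAs ((restrictScalars F).Linear K)
  have h₃ : e.inverse.Linear K := inferInstance
  refine ⟨homMk (A := B) (B := A) e.inverse, ?_, ?_⟩
  · exact (homMk_eq_iff (e.inverse ⋙ e.functor) (𝟭 _)).2 ⟨e.counitIso⟩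
  · exact (homMk_eq_iff (e.functor ⋙ e.inverse) (𝟭 _)).2 ⟨e.unitIso.symm⟩

end ModHo

/-- Isomorphic objects of the Morita homotopy category have equivalent module categories. -/
theorem exists_modEquivalence {A B : KCat K} (e : (toHo K).obj A ≅ (toHo K).obj B) :
    ∃ Φ : Mod A ≌ Mod B, Φ.functor.Additive ∧ Φ.functor.Linear K := by
  -- Morphisms of `ModHo` are isomorphism classes, so an isomorphism there is a pair of mutually
  -- quasi-inverse linear functors.
  let e' : (⟨A⟩ : ModHo K) ≅ ⟨B⟩ :=
    (Localization.Construction.lift _ ModHo.isInvertedBy_res).mapIso e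
  obtain ⟨F, _, _, hF⟩ := ModHo.exists_homMk e'.hom
  obtain ⟨G, hG₁, hG₂, hG⟩ := ModHo.exists_homMk e'.inv
  have h₁ := e'.hom_inv_id
  have h₂ := e'.inv_hom_id
  rw [hF, hG, ModHo.homMk_comp, ← ModHo.homMk_id, ModHo.homMk_eq_iff] at h₁ h₂
  obtain ⟨α⟩ := h₁
  obtain ⟨β⟩ := h₂
  exact ⟨CategoryTheory.Equivalence.mk G F α.symm β, hG₁, hG₂⟩

/-! ### Full subcategories spanned by small families -/

section OfFamily

variable {𝓜 : Type*} [Category.{u} 𝓜] [Preadditive 𝓜] [Linear K 𝓜] {ι : Type u}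

/-- The `K`-category spanned by a small family of objects of a `K`-linear category. -/
def ofFamily (X : ι → 𝓜) : KCat K where
  carrier := InducedCategory 𝓜 X

/-- The inclusion of the `K`-category spanned by a family. -/
abbrev familyInclusion (X : ι → 𝓜) : (ofFamily (K := K) X : Type u) ⥤ 𝓜 := inducedFunctor X

instance (X : ι → 𝓜) : (familyInclusion (K := K) X).Additive :=
  inferInstanceAs (inducedFunctor X).Additive

instance (X : ι → 𝓜) : (familyInclusion (K := K) X).Linear K :=
  inferInstanceAs ((inducedFunctor X).Linear K)

instance (X : ι → 𝓜) : (familyInclusion (K := K) X).Full :=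
  inferInstanceAs (inducedFunctor X).Full

instance (X : ι → 𝓜) : (familyInclusion (K := K) X).Faithful :=
  inferInstanceAs (inducedFunctor X).Faithful

/-- The lift of a `K`-linear functor to the `K`-category spanned by a family. -/
def toFamily (X : ι → 𝓜) {A : KCat K} (F : (A : Type u) ⥤ 𝓜) [F.Additive] [F.Linear K]
    (i : A → ι) (e : ∀ a, X (i a) ≅ F.obj a) : A ⟶ ofFamily (K := K) X where
  functor :=
    { obj := i
      map := fun {a b} f => InducedCategory.homMk ((e a).hom ≫ F.map f ≫ (e b).inv)
      map_id := fun a => InducedCategory.hom_ext (by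
        change _ = 𝟙 (X (i a))
        simp)
      map_comp := fun {a b c} f g => InducedCategory.hom_ext (by
        change _ = ((e a).hom ≫ F.map f ≫ (e b).inv) ≫ ((e b).hom ≫ F.map g ≫ (e c).inv)
        simp) }
  additive := ⟨fun {a b f g} => InducedCategory.hom_ext (by
    change _ = (e a).hom ≫ F.map f ≫ (e b).inv + (e a).hom ≫ F.map g ≫ (e b).inv
    simp)⟩
  linear := ⟨fun {a b} f r => InducedCategory.hom_ext (by
    change _ = r • ((e a).hom ≫ F.map f ≫ (e b).inv)
    simp)⟩

/-- Every cospan of dense functors below arises in this way, from two fully faithful functors into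
one ambient category whose images generate each other. -/
theorem isDense_toFamily (X : ι → 𝓜) {A : KCat K} (F : (A : Type u) ⥤ 𝓜) [F.Additive] [F.Linear K]
    [F.Full] [F.Faithful] (i : A → ι) (e : ∀ a, X (i a) ≅ F.obj a)
    (h : ∀ j, GeneratedBy K F.obj (X j)) : IsDense (toFamily (K := K) X F i e) where
  full := ⟨fun {a b} g =>
    ⟨F.preimage ((e a).inv ≫ g.hom ≫ (e b).hom), InducedCategory.hom_ext (by simp [toFamily])⟩⟩
  faithful := ⟨fun {a b f g} hfg => by
    have : (e a).hom ≫ F.map f ≫ (e b).inv = (e a).hom ≫ F.map g ≫ (e b).inv :=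
      congrArg InducedCategory.Hom.hom hfg
    exact F.map_injective (by simpa using this)⟩
  generated := fun j => GeneratedBy.of_map (familyInclusion X)
    ((h j).trans fun a => (GeneratedBy.self (G := fun a => X (i a)) a).of_iso (e a))

end OfFamily

/-- A `K`-linear equivalence of module categories yields a common dense extension. -/
theorem exists_isDense_of_modEquivalence {A B : KCat K} (Φ : Mod A ≌ Mod B)
    [Φ.functor.Additive] [Φ.functor.Linear K] :
    ∃ (D : KCat K) (F : A ⟶ D) (G : B ⟶ D), IsDense F ∧ IsDense G := by
  -- The common extension is spanned by the representables of `B` and the images of those of `A`.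
  -- Each of these families separates `Mod B`, because `Φ` is an equivalence, so each generates the
  -- other.
  let X : A ⊕ B → Mod B := Sum.elim (fun a => Φ.functor.obj ((yoneda A).obj a)) (yoneda B).obj
  refine ⟨ofFamily X, toFamily X (yoneda A ⋙ Φ.functor) Sum.inl fun _ => Iso.refl _,
    toFamily X (yoneda B) Sum.inr fun _ => Iso.refl _, isDense_toFamily _ _ _ _ ?_,
    isDense_toFamily _ _ _ _ ?_⟩
  · rintro (a | b)
    · exact GeneratedBy.self (G := (yoneda A ⋙ Φ.functor).obj) a
    · refine generatedBy_of_separating _ (fun {M N} φ ψ h => ?_) b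
      apply Φ.inverse.map_injective
      refine separating_yoneda _ _ fun a f => ?_
      apply Φ.functor.map_injective
      have := h a (Φ.functor.map f ≫ Φ.counit.app M)
      simpa using congr($this ≫ Φ.counitInv.app N)
  · rintro (a | b)
    · have key : GeneratedBy K (fun b => Φ.inverse.obj ((yoneda B).obj b)) ((yoneda A).obj a) := by
        refine generatedBy_of_separating _ (fun {M N} φ ψ h => ?_) a
        apply Φ.functor.map_injective
        refine separating_yoneda _ _ fun b f => ?_
        apply Φ.inverse.map_injective
        have := h b (Φ.inverse.map f ≫ Φ.unitInv.app M)
        simpa using congr($this ≫ Φ.unit.app N)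
      exact (key.map Φ.functor).trans fun b =>
        (GeneratedBy.self (G := (yoneda B).obj) b).of_iso (Φ.counitIso.app _).symm
    · exact GeneratedBy.self (G := (yoneda B).obj) b

theorem exists_isDense_of_iso {A B : KCat K} (e : (toHo K).obj A ≅ (toHo K).obj B) :
    ∃ (D : KCat K) (F : A ⟶ D) (G : B ⟶ D), IsDense F ∧ IsDense G := by
  obtain ⟨Φ, _, _⟩ := exists_modEquivalence e
  exact exists_isDense_of_modEquivalence Φ

theorem IsDense.nonempty_iso {A B : KCat K} {F : A ⟶ B} (h : IsDense F) :
    Nonempty ((toHo K).obj A ≅ (toHo K).obj B) :=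
  ⟨Localization.Construction.wIso F ((isMoritaEquivalence_iff_isDense F).2 h)⟩

theorem IsDense.moritaEquivalent {A B : KCat K} {F : A ⟶ B} (h : IsDense F) :
    MoritaEquivalent A B :=
  Relation.EqvGen.rel _ _ ⟨F, (isMoritaEquivalence_iff_isDense F).2 h⟩

end KCat

/-! ### Linear structure and finite sums in the additive completion -/

namespace CategoryTheory.Mat_

variable {K : Type*} [CommRing K] {C : Type*} [Category* C] [Preadditive C] [Linear K C]

instance : Linear K (Mat_ C) where
  homModule M N := inferInstanceAs (Module K (∀ i j, M.X i ⟶ N.X j))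
  smul_comp M N P r f g := by
    ext i k
    simp only [comp_apply]
    exact (Finset.sum_congr rfl fun j _ => Linear.smul_comp _ _ _ r (f i j) (g j k)).trans
      Finset.smul_sum.symm
  comp_smul M N P f r g := by
    ext i k
    simp only [comp_apply]
    exact (Finset.sum_congr rfl fun j _ => Linear.comp_smul _ _ _ (f i j) r (g j k)).trans
      Finset.smul_sum.symm

instance : (embedding C).Linear K where
  map_smul _ _ := rfl

/-- The inclusion of a component. -/
noncomputable def single (M : Mat_ C) (i : M.ι) : (embedding C).obj (M.X i) ⟶ M :=
  fun _ k => (𝟙 M : Hom M M) i k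

/-- The projection to a component. -/
noncomputable def proj (M : Mat_ C) (i : M.ι) : M ⟶ (embedding C).obj (M.X i) :=
  fun k _ => (𝟙 M : Hom M M) k i

theorem single_proj (M : Mat_ C) (i : M.ι) : M.single i ≫ M.proj i = 𝟙 _ := by
  ext ⟨⟩ ⟨⟩
  exact congr($(Category.id_comp (𝟙 M)) i i).trans ((id_apply_self M i).trans
    (id_apply_self ((embedding C).obj (M.X i)) PUnit.unit).symm)

theorem sum_proj_single (M : Mat_ C) : ∑ i, M.proj i ≫ M.single i = 𝟙 M := by
  ext i j
  have h : ∀ s : Finset M.ι, (∑ k ∈ s, M.proj k ≫ M.single k) i j =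
      ∑ k ∈ s, (M.proj k ≫ M.single k) i j := fun s =>
    map_sum (⟨⟨fun f : M ⟶ M => f i j, rfl⟩, fun _ _ => rfl⟩ : (M ⟶ M) →+ (M.X i ⟶ M.X j)) _ s
  rw [h]
  -- `single` and `proj` are the rows and columns of the identity matrix, so the sum is the entry of
  -- `𝟙 M ≫ 𝟙 M`.
  refine Eq.trans ?_ congr($(Category.id_comp (𝟙 M)) i j)
  refine Eq.trans ?_ (comp_apply (𝟙 M) (𝟙 M) i j).symm
  exact Finset.sum_congr rfl fun k _ =>
    (comp_apply (M.proj k) (M.single k) i j).trans (Fintype.sum_unique (ι := PUnit) _)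

end CategoryTheory.Mat_

namespace KCat

variable {K : Type u} [CommRing K]

/-! ### Algebras and objects of linear categories -/

/-- The inclusion of the endomorphism algebra of an object. -/
def endFunctor {𝓜 : Type*} [Category.{u} 𝓜] [Preadditive 𝓜] (X : 𝓜) : AlgObj (End X) ⥤ 𝓜 where
  obj _ := X
  map f := f

section

variable {𝓜 : Type*} [Category.{u} 𝓜] [Preadditive 𝓜] [Linear K 𝓜] (X : 𝓜)

variable (K) in
/-- The inclusion of the endomorphism algebra of an object, as a functor of `K`-categories. -/
def endInclusion : (ofAlgebra K (End X) : Type u) ⥤ 𝓜 := endFunctor X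

instance : (endInclusion K X).Additive where
instance : (endInclusion K X).Linear K where
instance : (endInclusion K X).Full := ⟨fun f => ⟨f, rfl⟩⟩
instance : (endInclusion K X).Faithful := ⟨id⟩

end

/-- A `K`-category generated by finitely many objects is Morita equivalent to an algebra. -/
theorem exists_algebra_of_generatedBy {A : KCat K} {n : ℕ} (a : Fin n → A)
    (h : ∀ x : A, GeneratedBy K a x) :
    ∃ (R : Type u) (_ : Ring R) (_ : Algebra K R) (C : KCat K) (F : A ⟶ C)
      (G : ofAlgebra K R ⟶ C), IsDense F ∧ IsDense G := by
  -- `M` is the formal sum of the generators. Each generator is a retract of `M`, and `M` is a sum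
  -- of generators, so `A` and `End M` are both dense in the category spanned by `M` and the objects
  -- of `A`.
  let M : Mat_ A := ⟨Fin n, a⟩
  let X : Option A → Mat_ A := fun x => x.elim M (Mat_.embedding A).obj
  have hM : ∀ x, GeneratedBy K (fun _ : AlgObj (End M) => M) ((Mat_.embedding A).obj x) := fun x =>
    ((h x).map (Mat_.embedding A)).trans fun i =>
      .of_sum {()} (fun _ => .star) (fun _ => M.single i) (fun _ => M.proj i) (by
        simpa using M.single_proj i)
  have hA : GeneratedBy K (Mat_.embedding A).obj M :=
    .of_sum Finset.univ a (fun i => M.proj i) (fun i => M.single i) M.sum_proj_single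
  refine ⟨End M, inferInstance, inferInstance, ofFamily X,
    toFamily X (Mat_.embedding A) some fun _ => Iso.refl _,
    toFamily X (endInclusion K M) (fun _ => none) fun _ => Iso.refl _,
    isDense_toFamily _ _ _ _ ?_, isDense_toFamily _ _ _ _ ?_⟩
  · rintro (_ | x)
    · exact hA
    · exact GeneratedBy.self x
  · rintro (_ | x)
    · exact GeneratedBy.self (G := fun _ : AlgObj (End M) => M) .star
    · exact hM x

/-! ### Tensor products -/

/-- An object of a tensor product. -/
def tensorObj {A B : KCat K} (a : A) (b : B) : tensor A B := ⟨a, b⟩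

/-- The Hom modules of a tensor product. -/
def tensorHomEquiv {A B : KCat K} (p q : tensor A B) :
    (p ⟶ q) ≃ₗ[K] (p.fst ⟶ q.fst) ⊗[K] (p.snd ⟶ q.snd) :=
  LinearEquiv.refl K _

/-- The tensor product of two morphisms. -/
def tmul {A B : KCat K} {p q : tensor A B} :
    (p.fst ⟶ q.fst) →ₗ[K] (p.snd ⟶ q.snd) →ₗ[K] (p ⟶ q) :=
  TensorProduct.mk K _ _

@[simp] theorem tensorHomEquiv_tmul {A B : KCat K} {p q : tensor A B} (f : p.fst ⟶ q.fst)
    (g : p.snd ⟶ q.snd) : tensorHomEquiv p q (tmul f g) = f ⊗ₜ g := rfl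

theorem tmul_comp_tmul {A B : KCat K} {p q r : tensor A B} (f : p.fst ⟶ q.fst)
    (g : p.snd ⟶ q.snd) (f' : q.fst ⟶ r.fst) (g' : q.snd ⟶ r.snd) :
    (tmul f g : p ⟶ q) ≫ (tmul f' g' : q ⟶ r) = tmul (f ≫ f') (g ≫ g') := rfl

theorem id_eq_tmul {A B : KCat K} (p : tensor A B) : 𝟙 p = tmul (𝟙 p.fst) (𝟙 p.snd) := rfl

theorem tensor_induction {A B : KCat K} {p q : tensor A B} {P : (p ⟶ q) → Prop} (f : p ⟶ q)
    (zero : P 0) (tmul : ∀ f g, P (tmul f g)) (add : ∀ f g, P f → P g → P (f + g)) : P f :=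
  TensorProduct.induction_on (motive := P) f zero tmul add

/-- A functor out of a tensor product from its values on pure tensors. -/
def tensorLift {A B C : KCat K} (obj : tensor A B → C)
    (map : ∀ p q : tensor A B, (p.fst ⟶ q.fst) →ₗ[K] (p.snd ⟶ q.snd) →ₗ[K] (obj p ⟶ obj q))
    (map_id : ∀ p, map p p (𝟙 _) (𝟙 _) = 𝟙 _)
    (map_comp : ∀ (p q r : tensor A B) (f : p.fst ⟶ q.fst) (g : p.snd ⟶ q.snd)
      (f' : q.fst ⟶ r.fst) (g' : q.snd ⟶ r.snd),
      map p r (f ≫ f') (g ≫ g') = map p q f g ≫ map q r f' g') : tensor A B ⟶ C where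
  functor :=
    { obj := obj
      map := fun {p q} f => TensorProduct.lift (map p q) (tensorHomEquiv p q f)
      map_id := map_id
      map_comp := fun {p q r} f g => by
        induction f using tensor_induction with
        | zero => simp
        | add f f' h h' => simp only [Preadditive.add_comp, map_add, h, h']
        | tmul f f' =>
          induction g using tensor_induction with
          | zero => simp
          | add g g' h h' => simp only [Preadditive.comp_add, map_add, h, h']
          | tmul g g' => simp [tmul_comp_tmul, map_comp] }
  additive := ⟨by simp⟩
  linear := ⟨by simp⟩

/-- The tensor product of two functors. -/
def tensorMap {A A' B B' : KCat K} (F : A ⟶ A') (G : B ⟶ B') : tensor A B ⟶ tensor A' B' :=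
  tensorLift (fun p => tensorObj (F.functor.obj p.fst) (G.functor.obj p.snd))
    (fun p q => (tmul (p := tensorObj (F.functor.obj p.fst) (G.functor.obj p.snd))
      (q := tensorObj (F.functor.obj q.fst) (G.functor.obj q.snd))).compl₁₂
        (F.functor.mapLinearMap K) (G.functor.mapLinearMap K))
    (fun p => congrArg₂ (fun f g => f ⊗ₜ[K] g) (F.functor.map_id p.fst) (G.functor.map_id p.snd))
    (fun _ _ _ f g f' g' => congrArg₂ (fun f g => f ⊗ₜ[K] g) (F.functor.map_comp f f')
      (G.functor.map_comp g g'))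

/-- Tensoring linear isomorphisms of Hom modules gives isomorphisms, and tensoring decompositions of
two identities decomposes the identity of the pair. -/
theorem isDense_tensorMap {A A' B B' : KCat K} {F : A ⟶ A'} {G : B ⟶ B'} (hF : IsDense F)
    (hG : IsDense G) : IsDense (tensorMap F G) := by
  have key (p q : tensor A B) : Function.Bijective
      ((tensorMap F G).functor.map : (p ⟶ q) → ((tensorMap F G).functor.obj p ⟶ _)) := by
    let e : (p ⟶ q) ≃ₗ[K] ((tensorMap F G).functor.obj p ⟶ (tensorMap F G).functor.obj q) :=
      TensorProduct.congr (homLinearEquiv F hF.full hF.faithful p.fst q.fst)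
        (homLinearEquiv G hG.full hG.faithful p.snd q.snd)
    refine Eq.subst (motive := Function.Bijective) ?_ e.bijective
    funext f
    induction f using tensor_induction with
    | zero => rw [Functor.map_zero]; exact map_zero _
    | add f g h h' => rw [Functor.map_add, ← h, ← h']; exact map_add _ _ _
    | tmul f g => rfl
  refine ⟨⟨(key _ _).2⟩, ⟨fun h => (key _ _).1 h⟩, fun p => ?_⟩
  obtain ⟨n, i, f, g, h⟩ := (hF.generated p.fst).exists_sum
  obtain ⟨n', i', f', g', h'⟩ := (hG.generated p.snd).exists_sum
  refine .of_sum (Finset.univ : Finset (Fin n × Fin n')) (fun k => ⟨i k.1, i' k.2⟩)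
    (fun k => tmul (f k.1) (f' k.2)) (fun k => tmul (g k.1) (g' k.2)) ?_
  rw [id_eq_tmul, ← h, ← h']
  simp only [map_sum, LinearMap.sum_apply]
  rw [Finset.univ_product_univ.symm, Finset.sum_product_right]
  rfl

/-- The symmetry of the tensor product. -/
def tensorSwap (A B : KCat K) : tensor A B ⟶ tensor B A :=
  tensorLift (fun p => tensorObj p.snd p.fst)
    (fun p q => (tmul (p := tensorObj p.snd p.fst) (q := tensorObj q.snd q.fst)).flip)
    (fun _ => rfl)
    (fun _ _ _ _ _ _ _ => rfl)

theorem isDense_tensorSwap (A B : KCat K) : IsDense (tensorSwap A B) := by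
  have key (p q : tensor A B) : Function.Bijective
      ((tensorSwap A B).functor.map : (p ⟶ q) → ((tensorSwap A B).functor.obj p ⟶ _)) := by
    let e : (p ⟶ q) ≃ₗ[K] ((tensorSwap A B).functor.obj p ⟶ (tensorSwap A B).functor.obj q) :=
      TensorProduct.comm K (p.fst ⟶ q.fst) (p.snd ⟶ q.snd)
    refine Eq.subst (motive := Function.Bijective) ?_ e.bijective
    funext f
    induction f using tensor_induction with
    | zero => rw [Functor.map_zero]; exact map_zero _
    | add f g h h' => rw [Functor.map_add, ← h, ← h']; exact map_add _ _ _
    | tmul f g => rfl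
  exact ⟨⟨(key _ _).2⟩, ⟨fun h => (key _ _).1 h⟩, fun p =>
    GeneratedBy.self (K := K) (G := (tensorSwap A B).functor.obj) (tensorObj p.snd p.fst)⟩

theorem isDense_id (A : KCat K) : IsDense (𝟙 A) where
  full := inferInstanceAs (𝟭 (A : Type u)).Full
  faithful := inferInstanceAs (𝟭 (A : Type u)).Faithful
  generated := fun a => GeneratedBy.self (G := fun a : A => a) a

theorem MoritaEquivalent.nonempty_tensor_iso {A A' : KCat K} (h : MoritaEquivalent A A')
    (B : KCat K) : Nonempty ((toHo K).obj (tensor A B) ≅ (toHo K).obj (tensor A' B)) := by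
  induction h with
  | rel A A' h =>
    obtain ⟨F, hF⟩ := h
    exact (isDense_tensorMap ((isMoritaEquivalence_iff_isDense F).1 hF)
      (isDense_id B)).nonempty_iso
  | refl A => exact ⟨Iso.refl _⟩
  | symm A A' _ ih => exact ih.map Iso.symm
  | trans A A' A'' _ _ ih ih' => exact ih.elim fun e => ih'.map e.trans

/-! ### The unit -/

/-- The Hom modules of the unit. -/
def unitHomEquiv (s t : tensorUnit K) : (s ⟶ t) ≃ₗ[K] K := LinearEquiv.refl K K

/-- Endomorphisms of an object coming from the unit are scalars. -/
noncomputable def unitScalar {D : KCat K} {G : tensorUnit K ⟶ D} (hG : IsDense G)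
    (s : tensorUnit K) : (G.functor.obj s ⟶ G.functor.obj s) ≃ₗ[K] K :=
  (homLinearEquiv G hG.full hG.faithful s s).symm ≪≫ₗ unitHomEquiv s s

theorem unitScalar_smul_id {D : KCat K} {G : tensorUnit K ⟶ D} (hG : IsDense G) {s : tensorUnit K}
    (f : G.functor.obj s ⟶ G.functor.obj s) : unitScalar hG s f • 𝟙 (G.functor.obj s) = f := by
  have h : unitScalar hG s f • 𝟙 s = (unitHomEquiv s s).symm (unitScalar hG s f) :=
    mul_one (M := K) _
  rw [← G.functor.map_id, ← G.functor.map_smul, h, unitScalar, LinearEquiv.trans_apply,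
    LinearEquiv.symm_apply_apply]
  exact (homLinearEquiv G hG.full hG.faithful s s).apply_symm_apply f

theorem unitScalar_id {D : KCat K} {G : tensorUnit K ⟶ D} (hG : IsDense G) (s : tensorUnit K) :
    unitScalar hG s (𝟙 _) = 1 := by
  have h : homLinearEquiv G hG.full hG.faithful s s (𝟙 s) = 𝟙 _ := G.functor.map_id s
  rw [← h, unitScalar, LinearEquiv.trans_apply, LinearEquiv.symm_apply_apply]
  rfl

/-- If a tensor product is Morita equivalent to the unit, then its first factor is generated by
finitely many objects. -/
theorem exists_finite_generators {A B D : KCat K} {J : tensor A B ⟶ D} (hJ : IsDense J)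
    {G : tensorUnit K ⟶ D} (hG : IsDense G) :
    ∃ (n : ℕ) (a : Fin n → A), ∀ x, GeneratedBy K a x := by
  have := hJ.full
  have := hJ.faithful
  let s : tensorUnit K := AlgObj.star
  obtain ⟨n, p, u, v, huv⟩ := (hJ.generated (G.functor.obj s)).exists_sum
  refine ⟨n, fun i => (p i).fst, fun x => ?_⟩
  -- In `D` the object `q` is generated by the unit object, which is generated by the `p j`; full
  -- faithfulness of `J` brings this back to `A ⊗ B`.
  have hp (q : tensor A B) : GeneratedBy K p q := by
    refine GeneratedBy.of_map J.functor ((hG.generated _).trans ?_)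
    rintro ⟨⟩
    exact .of_sum Finset.univ id u v huv
  -- An endomorphism `β` of the second component of `p j` goes to the scalar `u j ≫ J (𝟙 ⊗ β) ≫ v
  -- j`. The values at the identities sum to `1`.
  let t (j : Fin n) : ((p j).snd ⟶ (p j).snd) →ₗ[K] K :=
    (unitScalar hG s).toLinearMap ∘ₗ Linear.leftComp K _ (u j) ∘ₗ Linear.rightComp K _ (v j) ∘ₗ
      J.functor.mapLinearMap K ∘ₗ tmul (p := p j) (q := p j) (𝟙 _)
  have ht : ∑ j, t j (𝟙 _) = 1 := by
    have h (j) : t j (𝟙 _) = unitScalar hG s (u j ≫ v j) := by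
      have : (tmul (𝟙 (p j).fst) (𝟙 (p j).snd) : p j ⟶ p j) = 𝟙 _ := rfl
      simp [t, this]
    rw [Finset.sum_congr rfl fun j _ => h j, ← map_sum, huv, unitScalar_id]
  -- Applying `t j` to the second tensor factor turns a decomposition of the identity of `(x, (p
  -- j).snd)` into one of `t j (𝟙 _) • 𝟙 x`. Summing over `j` decomposes `𝟙 x`.
  have key (j : Fin n) : t j (𝟙 _) • 𝟙 x ∈ sumThrough K (fun i => (p i).fst) x x := by
    let q : tensor A B := ⟨x, (p j).snd⟩
    let l : (q ⟶ q) →ₗ[K] (x ⟶ x) :=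
      TensorProduct.lift (LinearMap.lsmul K (x ⟶ x) ∘ₗ t j).flip ∘ₗ (tensorHomEquiv q q).toLinearMap
    have hl (f g) : l (tmul f g) = t j g • f := rfl
    have hle : sumThrough K p q q ≤ (sumThrough K (fun i => (p i).fst) x x).comap l := by
      refine sumThrough_le fun i f g => ?_
      rw [Submodule.mem_comap]
      induction f using tensor_induction with
      | zero => simp
      | add f f' h h' => rw [Preadditive.add_comp, map_add]; exact add_mem h h'
      | tmul f f' =>
        induction g using tensor_induction with
        | zero => simp
        | add g g' h h' => rw [Preadditive.comp_add, map_add]; exact add_mem h h'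
        | tmul g g' =>
          rw [tmul_comp_tmul, hl]
          exact Submodule.smul_mem _ _ (comp_mem_sumThrough (G := fun i => (p i).fst) (i := i) f g)
    have := hle (hp q)
    rwa [Submodule.mem_comap, id_eq_tmul, hl] at this
  have := Submodule.sum_mem _ fun j (_ : j ∈ Finset.univ) => key j
  rwa [← Finset.sum_smul, ht, one_smul] at this

end KCat

/-! ### Generalized matrix units and Azumaya algebras -/

section Azumaya

open MulOpposite

variable (K : Type*) [CommRing K]

/-- A system of generalized matrix units in an algebra: `unit i j` is the rank one operator given
by the `i`-th generator and the `j`-th cogenerator of a Morita context with the base ring. -/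
structure MatrixUnits (E : Type*) [Ring E] [Algebra K E] (κ : Type*) [Fintype κ] where
  unit : κ → κ → E
  coeff : κ → κ → E →ₗ[K] K
  sum_unit : ∑ k, unit k k = 1
  unit_mul_mul_unit : ∀ i k x l j, unit i k * x * unit l j = coeff k l x • unit i j

variable {K}

namespace MatrixUnits

variable {E : Type*} [Ring E] [Algebra K E] {κ : Type*} [Fintype κ] (m : MatrixUnits K E κ)

include m

/-- Sandwich `x` between two copies of `1 = ∑ unit k k`. -/
theorem sum_coeff_smul_unit (x : E) : ∑ k, ∑ l, m.coeff k l x • m.unit k l = x := by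
  conv_rhs => rw [← one_mul x, ← mul_one (1 * x), ← m.sum_unit]
  simp only [Finset.sum_mul, Finset.mul_sum, m.unit_mul_mul_unit]
  exact Finset.sum_comm

/-- The inverse is the one for matrix algebras: `T` goes to the sum of `T (unit k l) * unit i k ⊗ op
(unit l i)`. -/
theorem mulLeftRight_bijective : Function.Bijective (AlgHom.mulLeftRight K E) := by
  let Ψ : Module.End K E →ₗ[K] E ⊗[K] Eᵐᵒᵖ := ∑ k, ∑ l, ∑ i,
    (TensorProduct.mk K E Eᵐᵒᵖ).flip (op (m.unit l i)) ∘ₗ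
      LinearMap.mulRight K (m.unit i k) ∘ₗ LinearMap.applyₗ (m.unit k l)
  have hΨ (T) : Ψ T = ∑ k, ∑ l, ∑ i, (T (m.unit k l) * m.unit i k) ⊗ₜ op (m.unit l i) := by
    simp [Ψ]
  constructor
  · refine Function.LeftInverse.injective (g := Ψ) fun w => ?_
    induction w using TensorProduct.induction_on with
    | zero => simp
    | add w w' h h' => rw [map_add, map_add, h, h']
    | tmul a b =>
      have h (k l i) : (a * m.unit k l * b.unop * m.unit i k) ⊗ₜ[K] op (m.unit l i) =
          (a * m.unit k k) ⊗ₜ op (m.coeff l i b.unop • m.unit l i) := by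
        rw [mul_assoc a, mul_assoc a, m.unit_mul_mul_unit, mul_smul_comm, MulOpposite.op_smul,
          TensorProduct.smul_tmul]
      simp only [hΨ, AlgHom.mulLeftRight_apply, h]
      simp only [← TensorProduct.tmul_sum, ← Finset.op_sum, m.sum_coeff_smul_unit, op_unop]
      rw [← TensorProduct.sum_tmul, ← Finset.mul_sum, m.sum_unit, mul_one]
  · refine fun T => ⟨Ψ T, LinearMap.ext fun x => ?_⟩
    have h (k l i) : T (m.unit k l) * m.unit i k * x * m.unit l i =
        m.coeff k l x • (T (m.unit k l) * m.unit i i) := by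
      rw [mul_assoc _ _ x, mul_assoc, m.unit_mul_mul_unit, mul_smul_comm]
    simp only [hΨ, map_sum, LinearMap.sum_apply, AlgHom.mulLeftRight_apply, unop_op, h]
    simp only [← Finset.smul_sum, ← Finset.mul_sum, m.sum_unit, mul_one]
    conv_rhs => rw [← m.sum_coeff_smul_unit x]
    simp only [map_sum, map_smul]

end MatrixUnits

variable {R S : Type*} [Ring R] [Algebra K R] [Ring S] [Algebra K S]

/-- The contraction of the second factor along a functional. -/
noncomputable def contractSnd (R : Type*) [Ring R] [Algebra K R] (τ : S →ₗ[K] K) :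
    R ⊗[K] S →ₗ[K] R :=
  (TensorProduct.rid K R).toLinearMap ∘ₗ τ.lTensor R

@[simp] theorem contractSnd_tmul (τ : S →ₗ[K] K) (r : R) (s : S) :
    contractSnd R τ (r ⊗ₜ s) = τ s • r := by
  simp [contractSnd]

/-- The map `i` inserts `1 : S`, and `ρ` applies `τ` to the product of the two `S`-components, so `ρ
∘ i` is the identity. On endomorphisms, `i` corresponds to `T ↦ T ⊗ id`, which gives injectivity,
and `ρ` to contracting `T (r ⊗ 1)`, which gives surjectivity. -/
theorem mulLeftRight_bijective_of_tensorProduct (τ : S →ₗ[K] K) (hτ : τ 1 = 1)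
    (h : Function.Bijective (AlgHom.mulLeftRight K (R ⊗[K] S))) :
    Function.Bijective (AlgHom.mulLeftRight K R) := by
  let ρ : (R ⊗[K] S) ⊗[K] (R ⊗[K] S)ᵐᵒᵖ →ₗ[K] R ⊗[K] Rᵐᵒᵖ :=
    (TensorProduct.rid K _).toLinearMap ∘ₗ
      TensorProduct.map ((opLinearEquiv K).toLinearMap.lTensor R) (τ ∘ₗ LinearMap.mul' K S) ∘ₗ
      (TensorProduct.tensorTensorTensorComm K R S R S).toLinearMap ∘ₗ
      (opLinearEquiv K).symm.toLinearMap.lTensor (R ⊗[K] S)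
  have hρ (a s b s') : ρ ((a ⊗ₜ s) ⊗ₜ op (b ⊗ₜ s')) = τ (s * s') • a ⊗ₜ op b := by
    simp [ρ]
  have key (w) (r : R) : AlgHom.mulLeftRight K R (ρ w) r =
      contractSnd R τ (AlgHom.mulLeftRight K (R ⊗[K] S) w (r ⊗ₜ 1)) := by
    induction w using TensorProduct.induction_on with
    | zero => simp
    | add w w' h h' => simp only [map_add, LinearMap.add_apply, h, h']
    | tmul x y =>
      obtain ⟨y, rfl⟩ := op_surjective y
      induction x using TensorProduct.induction_on with
      | zero => simp
      | add w w' h h' => simp only [map_add, LinearMap.add_apply, TensorProduct.add_tmul, h, h']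
      | tmul a s =>
        induction y using TensorProduct.induction_on with
        | zero => simp
        | add w w' h h' =>
          simp only [map_add, LinearMap.add_apply, TensorProduct.tmul_add, MulOpposite.op_add,
            h, h']
        | tmul b s' => simp [hρ]
  let i : R ⊗[K] Rᵐᵒᵖ →ₗ[K] (R ⊗[K] S) ⊗[K] (R ⊗[K] S)ᵐᵒᵖ :=
    TensorProduct.map ((TensorProduct.mk K R S).flip 1)
      ((opLinearEquiv K).toLinearMap ∘ₗ (TensorProduct.mk K R S).flip 1 ∘ₗ
        (opLinearEquiv K).symm.toLinearMap)
  have hi (a b) : i (a ⊗ₜ b) = (a ⊗ₜ 1) ⊗ₜ op (b.unop ⊗ₜ 1) := rfl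
  have hρi (w) : ρ (i w) = w := by
    induction w using TensorProduct.induction_on with
    | zero => simp
    | add w w' h h' => rw [map_add, map_add, h, h']
    | tmul a b => simp [hi, hρ, hτ]
  have hμi (w) : AlgHom.mulLeftRight K (R ⊗[K] S) (i w) =
      (AlgHom.mulLeftRight K R w).rTensor S := by
    induction w using TensorProduct.induction_on with
    | zero => simp
    | add w w' h h' => rw [map_add, map_add, h, h', map_add, LinearMap.rTensor_add]
    | tmul a b =>
      refine TensorProduct.ext' fun r s => ?_
      simp [hi]
  constructor
  · rw [injective_iff_map_eq_zero]
    intro w hw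
    have h0 : AlgHom.mulLeftRight K (R ⊗[K] S) (i w) = 0 := by
      rw [hμi, hw, LinearMap.rTensor_zero]
    rw [← hρi w, (injective_iff_map_eq_zero _).1 h.1 _ h0, map_zero]
  · intro T
    obtain ⟨w, hw⟩ := h.2 (T.rTensor S)
    refine ⟨ρ w, LinearMap.ext fun r => ?_⟩
    rw [key, hw, LinearMap.rTensor_tmul, contractSnd_tmul, hτ, one_smul]

/-- A tensor factor of an algebra with generalized matrix units and a unital functional is
Azumaya. -/
theorem isAzumaya_of_matrixUnits {κ : Type*} [Fintype κ] (m : MatrixUnits K (R ⊗[K] S) κ)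
    (τ : R ⊗[K] S →ₗ[K] K) (hτ : τ 1 = 1) : IsAzumaya K R := by
  let τS : S →ₗ[K] K := τ ∘ₗ TensorProduct.mk K R S 1
  have hτS : τS 1 = 1 := hτ
  -- `l` takes the coefficients of `r ⊗ 1`; `s` rebuilds the element and contracts `S` by `τS`. Thus
  -- `R` is a retract of a finite free module.
  let l : R →ₗ[K] (κ × κ → K) :=
    LinearMap.pi fun k => m.coeff k.1 k.2 ∘ₗ (TensorProduct.mk K R S).flip 1
  let s : (κ × κ → K) →ₗ[K] R :=
    contractSnd R τS ∘ₗ Fintype.linearCombination K fun k => m.unit k.1 k.2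
  have hsl : s ∘ₗ l = LinearMap.id := by
    ext r
    have := m.sum_coeff_smul_unit (r ⊗ₜ 1)
    rw [← Fintype.sum_prod_type'] at this
    simp [s, l, Fintype.linearCombination_apply, this, hτS, -map_sum]
  have h₁ : Module.Projective K R := Module.Projective.of_split l s hsl
  have h₂ : Module.Finite K R :=
    Module.Finite.of_surjective s fun r => ⟨l r, LinearMap.congr_fun hsl r⟩
  have h₃ : FaithfulSMul K R := by
    rw [faithfulSMul_iff_algebraMap_injective]
    refine Function.LeftInverse.injective (g := τ ∘ₗ (TensorProduct.mk K R S).flip 1) fun c => ?_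
    rw [Algebra.algebraMap_eq_smul_one, map_smul]
    exact (congrArg (c • ·) hτ).trans (mul_one c)
  exact { bij := mulLeftRight_bijective_of_tensorProduct τS hτS m.mulLeftRight_bijective }

/-- An Azumaya algebra generates the base ring: its trace ideal is the unit ideal. -/
theorem IsAzumaya.exists_sum_eq_one (R : Type*) [Ring R] [Algebra K R] [IsAzumaya K R] :
    ∃ (n : ℕ) (f : Fin n → R →ₗ[K] K) (r : Fin n → R), ∑ k, f k (r k) = 1 := by
  -- `I` is the trace ideal. A section of the free cover gives `R = I R`; by Nakayama some `c` with
  -- `c - 1 ∈ I` kills `R`, and `c = 0` by faithfulness.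
  let I : Ideal K := Submodule.span K {c | ∃ (f : R →ₗ[K] K) (r : R), f r = c}
  have hI : (⊤ : Submodule K R) ≤ I • ⊤ := by
    intro r _
    obtain ⟨s, hs⟩ := Module.projective_def.1 (inferInstance : Module.Projective K R)
    rw [← hs r, Finsupp.linearCombination_apply]
    exact Submodule.sum_mem _ fun i _ => Submodule.smul_mem_smul
      (Submodule.subset_span ⟨Finsupp.lapply i ∘ₗ s, r, rfl⟩) trivial
  obtain ⟨c, hc, hc'⟩ := Submodule.exists_sub_one_mem_and_smul_eq_zero_of_fg_of_le_smul I ⊤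
    Module.Finite.fg_top hI
  have h0 : c = 0 := by
    have := hc' 1 trivial
    rw [← Algebra.algebraMap_eq_smul_one] at this
    exact (map_eq_zero_iff _ (FaithfulSMul.algebraMap_injective K R)).1 this
  rw [h0, zero_sub, neg_mem_iff] at hc
  obtain ⟨n, c, s, h⟩ := Submodule.mem_span_set'.1 hc
  choose f r hfr using fun k => (s k).2
  exact ⟨n, fun k => c k • f k, r, by simpa [hfr] using h⟩

end Azumaya

/-! ### From dense functors to Azumaya algebras -/

namespace KCat

variable {K : Type u} [CommRing K] {R S : Type u} [Ring R] [Algebra K R] [Ring S] [Algebra K S]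

/-- The object of the tensor product of two algebras. -/
def algStar (K R S : Type u) [CommRing K] [Ring R] [Algebra K R] [Ring S] [Algebra K S] :
    tensor (ofAlgebra K R) (ofAlgebra K S) := ⟨.star, .star⟩

/-- The endomorphism algebra of the object of the tensor product of two algebras. -/
def algHomEquiv (p q : tensor (ofAlgebra K R) (ofAlgebra K S)) : R ⊗[K] S ≃ₗ[K] (p ⟶ q) :=
  LinearEquiv.refl K (R ⊗[K] S)

/-- The order reverses because composition in `ofAlgebra` is `f ≫ g = g * f`. -/
theorem algHomEquiv_mul (p : tensor (ofAlgebra K R) (ofAlgebra K S)) (x y : R ⊗[K] S) :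
    algHomEquiv p p (x * y) = algHomEquiv p p y ≫ algHomEquiv p p x := by
  induction x using TensorProduct.induction_on with
  | zero => simp
  | add x x' h h' => rw [add_mul, map_add, map_add, h, h', Preadditive.comp_add]
  | tmul a s =>
    induction y using TensorProduct.induction_on with
    | zero => simp
    | add x x' h h' => rw [mul_add, map_add, map_add, h, h', Preadditive.add_comp]
    | tmul b t => exact congrArg (algHomEquiv p p) (Algebra.TensorProduct.tmul_mul_tmul a b s t)

theorem isAzumaya_of_isDense {D : KCat K} {J : tensor (ofAlgebra K R) (ofAlgebra K S) ⟶ D}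
    (hJ : IsDense J) {G : tensorUnit K ⟶ D} (hG : IsDense G) : IsAzumaya K R := by
  let s : tensorUnit K := AlgObj.star
  let p := algStar K R S
  let J' : R ⊗[K] S ≃ₗ[K] (J.functor.obj p ⟶ J.functor.obj p) :=
    algHomEquiv p p ≪≫ₗ homLinearEquiv J hJ.full hJ.faithful p p
  have J'_mul (x y) : J' (x * y) = J' y ≫ J' x :=
    (congrArg J.functor.map (algHomEquiv_mul p x y)).trans (J.functor.map_comp _ _)
  have J'_one : J' 1 = 𝟙 _ := J.functor.map_id p
  obtain ⟨n, i, f, g, hfg⟩ := (hG.generated (J.functor.obj p)).exists_sum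
  obtain rfl : i = fun _ => s := rfl
  -- The identity of the object of `R ⊗ S` is a sum through copies of the unit object. The
  -- composites `g l ≫ J' x ≫ f k` are endomorphisms of the unit object, hence scalars: these are
  -- the coefficients.
  let m : MatrixUnits K (R ⊗[K] S) (Fin n) :=
    { unit := fun i k => J'.symm (f k ≫ g i)
      coeff := fun k l => (unitScalar hG s).toLinearMap ∘ₗ Linear.leftComp K _ (g l) ∘ₗ
        Linear.rightComp K _ (f k) ∘ₗ J'.toLinearMap
      sum_unit := by rw [← map_sum, hfg, LinearEquiv.symm_apply_eq, J'_one]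
      unit_mul_mul_unit := fun i k x l j => by
        apply J'.injective
        rw [J'_mul, J'_mul, map_smul]
        simp only [LinearEquiv.apply_symm_apply]
        have := unitScalar_smul_id hG (g l ≫ J' x ≫ f k)
        have h : (f j ≫ g l) ≫ J' x ≫ f k ≫ g i = f j ≫ (g l ≫ J' x ≫ f k) ≫ g i := by
          simp only [Category.assoc]
        rw [h, ← this, Linear.smul_comp, Linear.comp_smul, Category.id_comp]
        rfl }
  obtain ⟨n', i', u, v, huv⟩ := (hJ.generated (G.functor.obj s)).exists_sum
  obtain rfl : i' = fun _ => p := rfl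
  -- The opposite retraction, of the unit object from copies of the object of `R ⊗ S`, gives the
  -- functional; `τ 1` is the scalar of the identity.
  let τ : R ⊗[K] S →ₗ[K] K := ∑ j, (unitScalar hG s).toLinearMap ∘ₗ Linear.leftComp K _ (u j) ∘ₗ
    Linear.rightComp K _ (v j) ∘ₗ J'.toLinearMap
  refine isAzumaya_of_matrixUnits m τ ?_
  have h (j) : ((unitScalar hG s).toLinearMap ∘ₗ Linear.leftComp K _ (u j) ∘ₗ
    Linear.rightComp K _ (v j) ∘ₗ J'.toLinearMap) 1 = unitScalar hG s (u j ≫ v j) := by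
    simp [J'_one]
  rw [LinearMap.sum_apply, Finset.sum_congr rfl fun j _ => h j, ← map_sum, huv, unitScalar_id]

end KCat

namespace KCat

open MulOpposite

variable {K : Type u} [CommRing K]

/-! ### Azumaya algebras are invertible -/

section

variable (K) (R : Type u) [Ring R] [Algebra K R]

/-- The enveloping algebra of `R` acts on `R`. -/
noncomputable def envelopingAction :
    (tensor (ofAlgebra K R) (ofAlgebra K Rᵐᵒᵖ) : Type u) ⥤ ModuleCat.{u} K where
  obj _ := ModuleCat.of K R
  map {p q} f := ModuleCat.ofHom (AlgHom.mulLeftRight K R ((algHomEquiv p q).symm f))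
  map_id _ := congrArg ModuleCat.ofHom (map_one (AlgHom.mulLeftRight K R))
  map_comp {p q r} f g := by
    have : (algHomEquiv p r).symm (f ≫ g) =
        (algHomEquiv q r).symm g * (algHomEquiv p q).symm f := by
      rw [LinearEquiv.symm_apply_eq]
      exact (algHomEquiv_mul p _ _).symm
    rw [this, map_mul]
    rfl

instance : (envelopingAction K R).Additive where
  map_add := congrArg ModuleCat.ofHom (map_add (AlgHom.mulLeftRight K R) _ _)

instance : (envelopingAction K R).Linear K where
  map_smul f r := congrArg ModuleCat.ofHom (map_smul (AlgHom.mulLeftRight K R) r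
    ((algHomEquiv _ _).symm f))

instance [IsAzumaya K R] : (envelopingAction K R).Full where
  map_surjective {p q} f := by
    obtain ⟨x, hx⟩ := (IsAzumaya.bij (R := K) (A := R)).2 f.hom
    exact ⟨algHomEquiv p q x, ModuleCat.hom_ext hx⟩

instance [IsAzumaya K R] : (envelopingAction K R).Faithful where
  map_injective {p q _ _} h := (algHomEquiv p q).symm.injective
    ((IsAzumaya.bij (R := K) (A := R)).1 congr(ModuleCat.Hom.hom $h))

/-- The unit acts on the regular module. -/
def unitAction : (tensorUnit K : Type u) ⥤ ModuleCat.{u} K where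
  obj _ := ModuleCat.of K K
  map {s t} f := unitHomEquiv s t f • 𝟙 _
  map_id _ := one_smul K _
  map_comp {s t w} f g := by
    have : unitHomEquiv s w (f ≫ g) = unitHomEquiv t w g * unitHomEquiv s t f := rfl
    rw [this, mul_smul, Linear.smul_comp, Linear.comp_smul, Category.comp_id, smul_comm]

instance : (unitAction K).Additive where
  map_add := add_smul (R := K) _ _ _

instance : (unitAction K).Linear K where
  map_smul f r := mul_smul (α := K) r (unitHomEquiv _ _ f) _

instance : (unitAction K).Full where
  map_surjective {s t} f := by
    refine ⟨(unitHomEquiv s t).symm (f.hom (1 : K)), ModuleCat.hom_ext (LinearMap.ext_ring ?_)⟩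
    exact mul_one (M := K) _

instance : (unitAction K).Faithful where
  map_injective {s t f g} h := by
    have : unitHomEquiv s t f * (1 : K) = unitHomEquiv s t g * 1 :=
      congr(ModuleCat.Hom.hom $h (1 : K))
    simpa using this

/-- The enveloping algebra of an Azumaya algebra is Morita equivalent to the base ring. -/
theorem nonempty_iso_unit_of_isAzumaya [IsAzumaya K R] :
    Nonempty ((toHo K).obj (tensor (ofAlgebra K R) (ofAlgebra K Rᵐᵒᵖ)) ≅
      (toHo K).obj (tensorUnit K)) := by
  let X : Option PUnit.{u + 1} → ModuleCat.{u} K := fun x =>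
    x.elim (ModuleCat.of K K) fun _ => ModuleCat.of K R
  let s : tensorUnit K := AlgObj.star
  -- A finitely generated projective module is a retract of some `K^n`.
  have h₁ : GeneratedBy K (unitAction K).obj (ModuleCat.of K R) := by
    obtain ⟨n, f, g, -, -, hfg⟩ := Module.Finite.exists_comp_eq_id_of_projective K R
    refine .of_sum Finset.univ (fun _ => s) (fun k => ModuleCat.ofHom (LinearMap.proj k ∘ₗ g))
      (fun k => ModuleCat.ofHom (f ∘ₗ LinearMap.single K (fun _ => K) k)) (ModuleCat.hom_ext ?_)
    rw [ModuleCat.hom_sum]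
    refine Eq.trans (LinearMap.ext fun r => ?_) hfg
    rw [LinearMap.sum_apply]
    refine Eq.trans (map_sum f (fun k => Pi.single k (g r k)) Finset.univ).symm ?_
    rw [Finset.univ_sum_single]
    rfl
  -- `∑ f k (r k) = 1` exhibits `K` as a retract of `R^n`.
  have h₂ : GeneratedBy K (envelopingAction K R).obj (ModuleCat.of K K) := by
    obtain ⟨n, f, r, h⟩ := IsAzumaya.exists_sum_eq_one (K := K) R
    refine .of_sum Finset.univ (fun _ => algStar K R Rᵐᵒᵖ)
      (fun k => ModuleCat.ofHom (LinearMap.toSpanSingleton K R (r k)))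
      (fun k => ModuleCat.ofHom (f k)) (ModuleCat.hom_ext (LinearMap.ext_ring ?_))
    rw [ModuleCat.hom_sum, LinearMap.sum_apply]
    refine Eq.trans (Finset.sum_congr rfl fun k _ => ?_) h
    exact congrArg (f k) (one_smul K (r k))
  have hF : IsDense (toFamily (K := K) X (envelopingAction K R) (fun _ => some ⟨⟩)
      fun _ => Iso.refl _) := by
    refine isDense_toFamily _ _ _ _ ?_
    rintro (_ | _)
    · exact h₂
    · exact GeneratedBy.self (G := (envelopingAction K R).obj) (algStar K R Rᵐᵒᵖ)
  have hG : IsDense (toFamily (K := K) X (unitAction K) (fun _ => none)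
      fun _ => Iso.refl _) := by
    refine isDense_toFamily _ _ _ _ ?_
    rintro (_ | _)
    · exact GeneratedBy.self (G := (unitAction K).obj) s
    · exact h₁
  exact hF.nonempty_iso.elim fun e => hG.nonempty_iso.map fun e' => e ≪≫ e'.symm

end

/-! ### Invertible objects are Azumaya algebras -/

theorem exists_algebra_of_iso_unit {A B : KCat K}
    (e : (toHo K).obj (tensor A B) ≅ (toHo K).obj (tensorUnit K)) :
    ∃ (R : Type u) (_ : Ring R) (_ : Algebra K R) (C : KCat K) (F : A ⟶ C)
      (G : ofAlgebra K R ⟶ C), IsDense F ∧ IsDense G := by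
  obtain ⟨D, J, G, hJ, hG⟩ := exists_isDense_of_iso e
  obtain ⟨n, a, ha⟩ := exists_finite_generators hJ hG
  exact exists_algebra_of_generatedBy a ha

theorem exists_isAzumaya_of_iso_unit {A B : KCat K}
    (e : (toHo K).obj (tensor A B) ≅ (toHo K).obj (tensorUnit K)) :
    ∃ (R : Type u) (_ : Ring R) (_ : Algebra K R),
      IsAzumaya K R ∧ A.MoritaEquivalent (KCat.ofAlgebra K R) := by
  obtain ⟨R, _, _, C, F, G, hF, hG⟩ := exists_algebra_of_iso_unit e
  -- Finite generation was proved for the first factor only; the symmetry yields an algebra for `B`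
  -- too.
  obtain ⟨e'⟩ := (isDense_tensorSwap B A).nonempty_iso
  obtain ⟨S, _, _, C', F', G', hF', hG'⟩ := exists_algebra_of_iso_unit (e' ≪≫ e)
  obtain ⟨e₁⟩ := (isDense_tensorMap hF hF').nonempty_iso
  obtain ⟨e₂⟩ := (isDense_tensorMap hG hG').nonempty_iso
  obtain ⟨D, J, U, hJ, hU⟩ := exists_isDense_of_iso (e₂ ≪≫ e₁.symm ≪≫ e)
  exact ⟨R, _, _, isAzumaya_of_isDense hJ hU, hF.moritaEquivalent.trans _ _ _
    (hG.moritaEquivalent.symm _ _)⟩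

end KCat

theorem proposition4p1 {K : Type u} [CommRing K] (A : KCat.{u} K) :
    ((KCat.toHo K).obj A).IsTensorInvertible ↔
      ∃ (R : Type u) (_ : Ring R) (_ : Algebra K R),
        IsAzumaya K R ∧ A.MoritaEquivalent (KCat.ofAlgebra K R) := by
  constructor
  · rintro ⟨Y, ⟨e⟩⟩
    exact KCat.exists_isAzumaya_of_iso_unit (A := A) (B := Y.out) e
  · rintro ⟨R, _, _, _, h⟩
    -- The inverse of `A` is the opposite algebra of `R`.
    obtain ⟨e⟩ := h.nonempty_tensor_iso (KCat.ofAlgebra K Rᵐᵒᵖ)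
    obtain ⟨e'⟩ := KCat.nonempty_iso_unit_of_isAzumaya K R
    exact ⟨(KCat.toHo K).obj (KCat.ofAlgebra K Rᵐᵒᵖ), ⟨e ≪≫ e'⟩⟩
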